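/- Let $k\ge 1$ and $0<\gamma\le 1$. For a probability measure $P$ on $\mathbb R^k$ let $K_P(\gamma)$ be the set of measurable $\phi:\mathbb R^k\to[0,1]$ with $\int\phi\,dP\ge\gamma$ and $\int\|y\|^2\phi(y)\,P(dy)<\infty$, and for $\phi\in K_P(\gamma)$ put $$T_P(\phi)=\frac{\int y\,\phi(y)\,P(dy)}{\int\phi\,dP},\qquad C_P(\phi)=\frac{\int (y-T_P(\phi))(y-T_P(\phi))'\phi(y)\,P(dy)}{\int\phi\,dP},$$ $$r_P(\phi)=\inf\{s>0: P(E(T_P(\phi),C_P(\phi),s))\ge\gamma\},\qquad E(\mu,\Sigma,\rho)=\{y\in\mathbb R^k:(y-\mu)'\Sigma^{-1}(y-\mu)\le\rho^2\}.$$ Call $\phi\in K_P(\gamma)$ minimizing for $P$ if it minimizes $\det C_P$ over $K_P(\gamma)$; then $(T_P(\phi),C_P(\phi))$ is called an MCD functional at $P$, and we put $\Theta(P)=(\mu,\Gamma,\rho)$ with $\mu=T_P(\phi)$, $\Gamma$ the symmetric positive semidefinite square root of $C_P(\phi)$, and $\rho=r_P(\phi)$ (a value that may depend on the choice of the minimizing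 $\phi$). For $\theta=(m,G,r)$ with $m\in\mathbb R^k$, $G$ symmetric positive definite and $r>0$, define $\Psi=(\Psi_1,\Psi_2,\Psi_3)$ by $$\Psi_1(y,\theta)=\mathbf 1_{\{\|G^{-1}(y-m)\|\le r\}}\,G^{-1}(y-m),$$ $$\Psi_2(y,\theta)=\mathbf 1_{\{\|G^{-1}(y-m)\|\le r\}}\big(G^{-1}(y-m)(y-m)'G^{-1}-I_k\big),\qquad \Psi_3(y,\theta)=\mathbf 1_{\{\|G^{-1}(y-m)\|\le r\}}-\gamma .$$ **Theorem.** Let $P_0$ be a probability measure on $\mathbb R^k$ such that $P_0(H)<\gamma$ for every hyperplane $H$, and $P_0(\partial E(\mu,\Sigma,\rho))=0$ for all $\mu\in\mathbb R^k$, all symmetric positive definite $\Sigma$ and all $\rho>0$. Suppose that the MCD functional $(\mu_0,\Sigma_0)=(T_{P_0}(\phi_0),C_{P_0}(\phi_0))$ is uniquely defined at $P_0$, that is, all minimizing functions for $P_0$ give the same pair. Write $\theta_0=\Theta(P_0)=(\mu_0,\Gamma_0,\rho_0)$ and suppose that $P_0(E(\mu_0,\Sigma_0,\rho_0+\varepsilon))>\gamma$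 for all $\varepsilon>0$. Suppose that $\Lambda(\theta)=\int\Psi(y,\theta)\,P_0(dy)$, regarded as a map with values in $\mathbb R^k\times\mathrm{Sym}(k)\times\mathbb R$ of $\theta$ near $\theta_0$ in that same space, where $\mathrm{Sym}(k)$ is the space of real symmetric $k\times k$ matrices, has a non-singular derivative $\Lambda'(\theta_0)$ at $\theta_0$. Let $x\in\mathbb R^k$ with $x\notin\partial E(\mu_0,\Sigma_0,\rho_0)$, and for $0<\varepsilon<1$ let $P_{\varepsilon,x}=(1-\varepsilon)P_0+\varepsilon\delta_x$, where $\delta_x$ is the Dirac measure at $x$. Then, for all sufficiently small $\varepsilon>0$, there is a minimizing function for $P_{\varepsilon,x}$ and $C_{P_{\varepsilon,x}}(\phi)$ is positive definite for every such function $\phi$; and, whatever minimizing functions are used to define $\Theta(P_{\varepsilon,x})$, the influence function of $\Theta$ at $P_0$ exists and is given by $$\mathrm{IF}(x,\Theta,P_0)=\lim_{\varepsilon\downarrow0}\frac{\Theta(P_{\varepsilon,x})-\Theta(P_0)}{\varepsilon}=-\Lambda'(\theta_0)^{-1}\,\Psi(x,\theta_0).$$ -/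

import Mathlib

open MeasureTheory Filter Topology
open scoped Matrix MatrixOrder

namespace MCD

/-- The symmetric real `k × k` matrices, as a linear subspace of all matrices. -/
def symSubmodule (k : ℕ) : Submodule ℝ (Matrix (Fin k) (Fin k) ℝ) where
  carrier := {A | A.IsSymm}
  add_mem' := fun {_ _} ha hb => Matrix.IsSymm.add ha hb
  zero_mem' := Matrix.isSymm_zero
  smul_mem' := fun c _ ha => Matrix.IsSymm.smul ha c

/-- The vector space `Sym(k)` of symmetric real `k × k` matrices. -/
def SymMat (k : ℕ) : Type := symSubmodule k

/-- The underlying matrix. -/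
def SymMat.mat {k : ℕ} (A : SymMat k) : Matrix (Fin k) (Fin k) ℝ := A.1

section Norm

/- `Sym(k)` carries the entrywise sup norm. All norms on this finite-dimensional space are
equivalent, so derivatives, integrals and limits do not depend on this choice. -/
attribute [local instance] Matrix.normedAddCommGroup Matrix.normedSpace

noncomputable instance (k : ℕ) : NormedAddCommGroup (SymMat k) :=
  inferInstanceAs (NormedAddCommGroup (symSubmodule k))

noncomputable instance (k : ℕ) : NormedSpace ℝ (SymMat k) :=
  inferInstanceAs (NormedSpace ℝ (symSubmodule k))

end Norm

instance (k : ℕ) : FiniteDimensional ℝ (SymMat k) :=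
  inferInstanceAs (FiniteDimensional ℝ (symSubmodule k))

/-- The space `ℝ^k × Sym(k) × ℝ`, in which the parameters `θ = (m, G, r)` live. The parameter set
`ℝ^k × PDS(k) × (0, ∞)` is an open subset of it. -/
abbrev Param (k : ℕ) : Type := EuclideanSpace ℝ (Fin k) × SymMat k × ℝ

section Functionals

variable {k : ℕ}

/-- The trimmed mean `T_P(φ)`. -/
noncomputable def trimMean (P : Measure (EuclideanSpace ℝ (Fin k)))
    (φ : EuclideanSpace ℝ (Fin k) → ℝ) : EuclideanSpace ℝ (Fin k) :=
  (∫ x, φ x ∂P)⁻¹ • ∫ x, φ x • x ∂P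

/-- The trimmed covariance matrix `C_P(φ)`. -/
noncomputable def trimCov (P : Measure (EuclideanSpace ℝ (Fin k)))
    (φ : EuclideanSpace ℝ (Fin k) → ℝ) : Matrix (Fin k) (Fin k) ℝ :=
  Matrix.of fun i j =>
    (∫ x, φ x ∂P)⁻¹ * ∫ x, (x i - trimMean P φ i) * (x j - trimMean P φ j) * φ x ∂P

/-- The class `K_P(γ)` of trimming functions. -/
def trimClass (P : Measure (EuclideanSpace ℝ (Fin k))) (γ : ℝ) :
    Set (EuclideanSpace ℝ (Fin k) → ℝ) :=
  {φ | Measurable φ ∧ (∀ x, φ x ∈ Set.Icc (0 : ℝ) 1) ∧ γ ≤ ∫ x, φ x ∂P ∧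
    Integrable (fun x => ‖x‖ ^ 2 * φ x) P}

/-- `φ` is a minimizing trimming function: it minimizes `det C_P` over `K_P(γ)`. -/
def IsMinimizing (P : Measure (EuclideanSpace ℝ (Fin k))) (γ : ℝ)
    (φ : EuclideanSpace ℝ (Fin k) → ℝ) : Prop :=
  φ ∈ trimClass P γ ∧ ∀ ψ ∈ trimClass P γ, (trimCov P φ).det ≤ (trimCov P ψ).det

/-- The ellipsoid `E(μ, Σ, ρ) = {x : (x - μ)' Σ⁻¹ (x - μ) ≤ ρ²}` (for `Σ` positive definite). -/
def ellipsoid (μ : EuclideanSpace ℝ (Fin k)) (S : Matrix (Fin k) (Fin k) ℝ) (ρ : ℝ) :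
    Set (EuclideanSpace ℝ (Fin k)) :=
  {x | (x - μ).ofLp ⬝ᵥ (S⁻¹ *ᵥ (x - μ).ofLp) ≤ ρ ^ 2}

/-- The radius `r_P(φ)`. -/
noncomputable def trimRadius (P : Measure (EuclideanSpace ℝ (Fin k))) (γ : ℝ)
    (φ : EuclideanSpace ℝ (Fin k) → ℝ) : ℝ :=
  sInf {s : ℝ | 0 < s ∧ γ ≤ P.real (ellipsoid (trimMean P φ) (trimCov P φ) s)}

/-- The symmetric positive semidefinite square root of a positive semidefinite matrix. -/
noncomputable def symSqrt (S : Matrix (Fin k) (Fin k) ℝ) : SymMat k :=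
  ⟨CFC.sqrt S, by
    have h : (CFC.sqrt S).IsHermitian := (Matrix.nonneg_iff_posSemidef.mp (CFC.sqrt_nonneg S)).1
    rw [Matrix.IsHermitian, Matrix.conjTranspose_eq_transpose_of_trivial] at h
    exact h⟩

/-- The parameter `θ_P(φ) = (μ, Γ, ρ)` with `μ = T_P(φ)`, `Γ² = C_P(φ)`, `ρ = r_P(φ)`.
For minimizing `φ` this is (a value of) the functional `Θ(P)`. -/
noncomputable def theta (P : Measure (EuclideanSpace ℝ (Fin k))) (γ : ℝ)
    (φ : EuclideanSpace ℝ (Fin k) → ℝ) : Param k :=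
  (trimMean P φ, symSqrt (trimCov P φ), trimRadius P γ φ)

/-- The perturbed measure `(1 - ε) P + ε δ_x`, for `0 ≤ ε ≤ 1`. -/
noncomputable def perturb (P : Measure (EuclideanSpace ℝ (Fin k))) (x : EuclideanSpace ℝ (Fin k))
    (ε : ℝ) : Measure (EuclideanSpace ℝ (Fin k)) :=
  ENNReal.ofReal (1 - ε) • P + ENNReal.ofReal ε • Measure.dirac x

/-- `G⁻¹ (y - m)`. -/
noncomputable def standardize (y : EuclideanSpace ℝ (Fin k)) (θ : Param k) :
    EuclideanSpace ℝ (Fin k) :=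
  WithLp.toLp 2 (θ.2.1.mat⁻¹ *ᵥ (y - θ.1).ofLp)

/-- The symmetric matrix `z z' - I_k`. For `z = G⁻¹ (y - m)` with `G` symmetric this is
`G⁻¹ (y - m) (y - m)' G⁻¹ - I_k`. -/
noncomputable def outerSubOne (z : EuclideanSpace ℝ (Fin k)) : SymMat k :=
  ⟨Matrix.vecMulVec z.ofLp z.ofLp - 1, by
    change (Matrix.vecMulVec z.ofLp z.ofLp - 1).IsSymm
    refine Matrix.IsSymm.sub ?_ Matrix.isSymm_one
    ext i j
    simp [Matrix.vecMulVec_apply, mul_comm]⟩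

/-- The score function `Ψ = (Ψ₁, Ψ₂, Ψ₃)`. -/
noncomputable def score (γ : ℝ) (y : EuclideanSpace ℝ (Fin k)) (θ : Param k) : Param k :=
  (if ‖standardize y θ‖ ≤ θ.2.2 then standardize y θ else 0,
   if ‖standardize y θ‖ ≤ θ.2.2 then outerSubOne (standardize y θ) else 0,
   (if ‖standardize y θ‖ ≤ θ.2.2 then 1 else 0) - γ)

/-- `Λ(θ) = ∫ Ψ(y, θ) P(dy)`. -/
noncomputable def meanScore (P : Measure (EuclideanSpace ℝ (Fin k))) (γ : ℝ) (θ : Param k) :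
    Param k :=
  ∫ y, score γ y θ ∂P

end Functionals

end MCD

set_option linter.unusedSectionVars false

namespace MCD

/-! `Θ` is treated as a Z-functional: its values solve estimating equations, and the influence
function is read off from linearizing these at `θ₀`.

The equations come from a concentration step. Replace a trimming function `φ` by one of mass exactly
`γ` carried by the smallest ellipsoid in the metric of `C_P(φ)` with mass at least `γ`. A
Neyman–Pearson comparison of the integrals of the squared distance, together with `det A ≤ det S ·
exp(tr(S⁻¹A) - k)`, shows that the determinant does not increase (`IsStep.det_le`). If `φ` is
minimizing and the boundary has mass less than `γ`, every inequality is an equality and `φ` is a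
step of itself (`IsMinimizing.isStep`). When the boundary is null, `φ` is then a.e. the indicator of
its ellipsoid, and the definitions of `T_P`, `C_P` and `r_P` become `∫ Ψ(y, Θ(P)) P(dy) = 0`
(`IsStep.meanScore_eq_zero`).

Existence of minimizers and continuity of `Θ` along `P_{ε,x}` share one compactness argument. Thin
slabs have mass uniformly below `γ`, and this survives small contamination; hence covariances are
bounded below, and a bound on the determinant bounds mean, covariance and radius
(`exists_param_bounds`). Along a subsequence the ellipsoids converge, and so do the trimming
functions almost everywhere, because limiting boundaries are null (`exists_subseq_isStep`). For
fixed `ε` this yields a minimizer. For `ε ↓ 0` the limit is minimizing for `P₀`; uniqueness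
identifies its mean and covariance, and the mass just outside the ellipsoid identifies its radius
(`tendsto_theta_perturb`).

Finally, with `θ_ε = Θ(P_{ε,x})`, one has `(1 - ε) Λ(θ_ε) + ε Ψ(x, θ_ε) = 0`, `θ_ε → θ₀` and `Λ(θ₀)
= 0`, while `Ψ(x, ·)` is continuous at `θ₀` because `x` is off the boundary. Invertibility of
`Λ'(θ₀)` first gives `θ_ε - θ₀ = O(ε)` and then the limit (`tendsto_diff_quotient_of_zero`).
Differentiability at the single point `θ₀` suffices, and no inverse function theorem is needed. -/

/-- The Euclidean space in which the observations live. -/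
abbrev Space (k : ℕ) : Type := EuclideanSpace ℝ (Fin k)

variable {k : ℕ}

/-! ### Quadratic forms -/

/-- The quadratic form `v' B v`. -/
def quad (B : Matrix (Fin k) (Fin k) ℝ) (v : Space k) : ℝ :=
  v.ofLp ⬝ᵥ (B *ᵥ v.ofLp)

theorem quad_eq_sum (B : Matrix (Fin k) (Fin k) ℝ) (v : Space k) :
    quad B v = ∑ i, ∑ j, B i j * (v i * v j) := by
  simp only [quad, dotProduct, Matrix.mulVec, Finset.mul_sum]
  refine Finset.sum_congr rfl fun i _ => Finset.sum_congr rfl fun j _ => by ring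

theorem continuous_quad_prod :
    Continuous fun p : Matrix (Fin k) (Fin k) ℝ × Space k => quad p.1 p.2 := by
  simp only [quad_eq_sum]
  have h : ∀ i j, Continuous fun p : Matrix (Fin k) (Fin k) ℝ × Space k => p.1 i j :=
    fun i j => continuous_fst.matrix_elem i j
  fun_prop

theorem continuous_quad (B : Matrix (Fin k) (Fin k) ℝ) : Continuous (quad B) :=
  continuous_quad_prod.comp (Continuous.prodMk_right B)

theorem quad_smul (B : Matrix (Fin k) (Fin k) ℝ) (c : ℝ) (v : Space k) :
    quad B (c • v) = c ^ 2 * quad B v := by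
  simp only [quad_eq_sum, Finset.mul_sum, PiLp.smul_apply, smul_eq_mul]
  refine Finset.sum_congr rfl fun i _ => Finset.sum_congr rfl fun j _ => by ring

theorem quad_one (v : Space k) : quad 1 v = ‖v‖ ^ 2 := by
  rw [EuclideanSpace.real_norm_sq_eq]
  simp [quad, dotProduct, sq]

theorem quad_vecMulVec_self (a v : Space k) :
    quad (Matrix.vecMulVec a.ofLp a.ofLp) v = (inner ℝ a v) ^ 2 := by
  simp only [quad_eq_sum, Matrix.vecMulVec_apply, PiLp.inner_apply, RCLike.inner_apply,
    conj_trivial, sq, Finset.sum_mul_sum]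
  refine Finset.sum_congr rfl fun i _ => Finset.sum_congr rfl fun j _ => by ring

theorem trace_vecMulVec_self_mul (a : Space k) (S : Matrix (Fin k) (Fin k) ℝ) :
    (Matrix.vecMulVec a.ofLp a.ofLp * S).trace = quad S a := by
  simp only [quad_eq_sum, Matrix.trace, Matrix.diag, Matrix.mul_apply, Matrix.vecMulVec_apply]
  rw [Finset.sum_comm]
  refine Finset.sum_congr rfl fun i _ => Finset.sum_congr rfl fun j _ => by ring

theorem quad_nonneg {B : Matrix (Fin k) (Fin k) ℝ} (hB : B.PosSemidef) (v : Space k) :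
    0 ≤ quad B v := by
  simpa [quad] using hB.dotProduct_mulVec_nonneg v.ofLp

theorem posDef_of_le_quad {S : Matrix (Fin k) (Fin k) ℝ} (hS : S.IsSymm) {l : ℝ} (hl : 0 < l)
    (h : ∀ a : Space k, l * ‖a‖ ^ 2 ≤ quad S a) : S.PosDef := by
  refine Matrix.PosDef.of_dotProduct_mulVec_pos (Matrix.isHermitian_iff_isSymm.2 hS) fun x hx => ?_
  have h1 := h (WithLp.toLp 2 x)
  have h2 : 0 < ‖WithLp.toLp 2 x‖ := norm_pos_iff.2 (by simpa using hx)
  have : 0 < quad S (WithLp.toLp 2 x) := lt_of_lt_of_le (by positivity) h1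
  simpa [quad] using this

/-! ### Square roots -/

theorem symSqrt_mul_self {S : Matrix (Fin k) (Fin k) ℝ} (hS : S.PosSemidef) :
    (symSqrt S).mat * (symSqrt S).mat = S :=
  CFC.sqrt_mul_sqrt_self S hS.nonneg

theorem symSqrt_isSymm (S : Matrix (Fin k) (Fin k) ℝ) : (symSqrt S).mat.IsSymm :=
  (symSqrt S).2

theorem symSqrt_posSemidef (S : Matrix (Fin k) (Fin k) ℝ) : (symSqrt S).mat.PosSemidef :=
  Matrix.nonneg_iff_posSemidef.mp (CFC.sqrt_nonneg S)

theorem isUnit_symSqrt {S : Matrix (Fin k) (Fin k) ℝ} (hS : S.PosDef) :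
    IsUnit (symSqrt S).mat.det := by
  have h := hS.det_pos.ne'
  rw [← symSqrt_mul_self hS.posSemidef, Matrix.det_mul] at h
  exact isUnit_iff_ne_zero.2 (left_ne_zero_of_mul h)

theorem inv_eq_symSqrt_inv_mul {S : Matrix (Fin k) (Fin k) ℝ} (hS : S.PosSemidef) :
    S⁻¹ = (symSqrt S).mat⁻¹ * (symSqrt S).mat⁻¹ := by
  conv_lhs => rw [← symSqrt_mul_self hS]
  exact Matrix.mul_inv_rev _ _

theorem symSqrt_inv_isSymm (S : Matrix (Fin k) (Fin k) ℝ) : ((symSqrt S).mat⁻¹).IsSymm := by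
  rw [Matrix.IsSymm, Matrix.transpose_nonsing_inv, (symSqrt_isSymm S).eq]

theorem quad_mul_self {G : Matrix (Fin k) (Fin k) ℝ} (hG : G.IsSymm) (v : Space k) :
    quad (G * G) v = ‖WithLp.toLp 2 (G *ᵥ v.ofLp)‖ ^ 2 := by
  rw [← quad_one]
  simp only [quad, Matrix.one_mulVec]
  rw [← Matrix.mulVec_mulVec, Matrix.dotProduct_mulVec, ← Matrix.mulVec_transpose, hG.eq]

theorem quad_inv_eq_norm_sq {S : Matrix (Fin k) (Fin k) ℝ} (hS : S.PosSemidef) (v : Space k) :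
    quad S⁻¹ v = ‖WithLp.toLp 2 ((symSqrt S).mat⁻¹ *ᵥ v.ofLp)‖ ^ 2 := by
  rw [inv_eq_symSqrt_inv_mul hS, quad_mul_self (symSqrt_inv_isSymm S)]

/-- Cauchy–Schwarz in each row; for symmetric `G` the trace of `G * G` is the squared Frobenius
norm. -/
theorem norm_mulVec_sq_le (G : Matrix (Fin k) (Fin k) ℝ) (hG : G.IsSymm) (u : Space k) :
    ‖WithLp.toLp 2 (G *ᵥ u.ofLp)‖ ^ 2 ≤ (G * G).trace * ‖u‖ ^ 2 := by
  rw [EuclideanSpace.real_norm_sq_eq, EuclideanSpace.real_norm_sq_eq, Matrix.trace, Finset.sum_mul]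
  refine Finset.sum_le_sum fun i _ => ?_
  have h := Finset.sum_mul_sq_le_sq_mul_sq Finset.univ (fun j => G i j) (fun j => u j)
  refine h.trans_eq ?_
  congr 1
  simp only [Matrix.diag, Matrix.mul_apply]
  refine Finset.sum_congr rfl fun j _ => ?_
  rw [sq, hG.apply i j]

theorem norm_sq_le_trace_mul_quad_inv {S : Matrix (Fin k) (Fin k) ℝ} (hS : S.PosDef)
    (v : Space k) : ‖v‖ ^ 2 ≤ S.trace * quad S⁻¹ v := by
  have h := norm_mulVec_sq_le (symSqrt S).mat (symSqrt_isSymm S)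
    (WithLp.toLp 2 ((symSqrt S).mat⁻¹ *ᵥ v.ofLp))
  rw [symSqrt_mul_self hS.posSemidef, ← quad_inv_eq_norm_sq hS.posSemidef] at h
  simpa [Matrix.mulVec_mulVec, Matrix.mul_nonsing_inv _ (isUnit_symSqrt hS)] using h

/-- With `w = S⁻¹ v`, both `quad S⁻¹ v` and `quad S w` equal `⟨w, v⟩`, so the lower bound on `S`
combines with Cauchy–Schwarz and no spectral theorem is needed. -/
theorem mul_quad_inv_le {S : Matrix (Fin k) (Fin k) ℝ} (hS : S.PosDef) {l : ℝ}
    (h : ∀ a : Space k, l * ‖a‖ ^ 2 ≤ quad S a) (v : Space k) : l * quad S⁻¹ v ≤ ‖v‖ ^ 2 := by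
  have hu : IsUnit S.det := isUnit_iff_ne_zero.2 hS.det_pos.ne'
  set w : Space k := WithLp.toLp 2 (S⁻¹ *ᵥ v.ofLp) with hw
  have hv : S *ᵥ w.ofLp = v.ofLp := by
    simp [hw, Matrix.mulVec_mulVec, Matrix.mul_nonsing_inv _ hu]
  have h1 : quad S⁻¹ v = inner ℝ w v := by
    simp only [quad, EuclideanSpace.inner_eq_star_dotProduct, hw, star_trivial]
  have h2 : quad S w = inner ℝ w v := by
    simp only [quad, EuclideanSpace.inner_eq_star_dotProduct, hv, star_trivial]
    exact dotProduct_comm _ _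
  have h3 := h w
  have h4 : inner ℝ w v ≤ ‖w‖ * ‖v‖ := real_inner_le_norm w v
  rw [h1]
  rw [h2] at h3
  rcases le_or_gt l 0 with hl | hl
  · have h0 : 0 ≤ inner ℝ w v := by rw [← h2]; exact quad_nonneg hS.posSemidef w
    nlinarith [mul_nonneg (neg_nonneg.2 hl) h0, sq_nonneg ‖v‖]
  · nlinarith [sq_nonneg (l * ‖w‖ - ‖v‖), norm_nonneg w, norm_nonneg v]

/-! ### Determinants and traces -/

/-- Multiply `t ≤ exp (t - 1)` over the eigenvalues. -/
theorem det_le_exp_trace {A : Matrix (Fin k) (Fin k) ℝ} (hA : A.PosSemidef) :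
    A.det ≤ Real.exp (A.trace - k) := by
  rw [hA.1.det_eq_prod_eigenvalues, hA.1.trace_eq_sum_eigenvalues]
  have : (∑ i, ((hA.1.eigenvalues i : ℝ) : ℝ)) - k = ∑ i, (hA.1.eigenvalues i - 1) := by
    simp
  simp only [RCLike.ofReal_real_eq_id, id] at this ⊢
  rw [this, Real.exp_sum]
  refine Finset.prod_le_prod (fun i _ => hA.eigenvalues_nonneg i) fun i _ => ?_
  have := Real.add_one_le_exp (hA.1.eigenvalues i - 1)
  linarith

/-- The previous bound applied to `G⁻¹ A G⁻¹`, where `G` is the square root of `S`. It turns trace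
inequalities, which are linear in the trimming function, into determinant inequalities. -/
theorem det_le_det_mul_exp {S A : Matrix (Fin k) (Fin k) ℝ} (hS : S.PosDef)
    (hA : A.PosSemidef) : A.det ≤ S.det * Real.exp ((S⁻¹ * A).trace - k) := by
  set G := (symSqrt S).mat with hG
  have hs := symSqrt_inv_isSymm S
  have h1 : (G⁻¹ * A * G⁻¹).PosSemidef := by
    have := hA.mul_mul_conjTranspose_same G⁻¹
    rwa [Matrix.conjTranspose_eq_transpose_of_trivial, hs.eq] at this
  have h2 := det_le_exp_trace h1
  have h3 : (G⁻¹ * A * G⁻¹).trace = (S⁻¹ * A).trace := by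
    rw [Matrix.trace_mul_comm, ← mul_assoc, inv_eq_symSqrt_inv_mul hS.posSemidef]
  have hu := isUnit_symSqrt hS
  have h4 : A.det = S.det * (G⁻¹ * A * G⁻¹).det := by
    have : A = G * (G⁻¹ * A * G⁻¹) * G := by
      rw [mul_assoc G, Matrix.nonsing_inv_mul_cancel_right _ _ hu, ← mul_assoc,
        Matrix.mul_nonsing_inv _ hu, one_mul]
    have e : S.det = G.det * G.det := by rw [← Matrix.det_mul, symSqrt_mul_self hS.posSemidef]
    conv_lhs => rw [this]
    rw [Matrix.det_mul, Matrix.det_mul G, e]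
    ring
  rw [h4, ← h3]
  exact mul_le_mul_of_nonneg_left h2 hS.det_pos.le

/-- All eigenvalues are at least `l`; dividing the determinant by the other `k - 1` eigenvalues
bounds each one from above. -/
theorem trace_le_of_det_le {S : Matrix (Fin k) (Fin k) ℝ} (hS : S.IsSymm) {l M : ℝ} (hl : 0 < l)
    (h : ∀ a : Space k, l * ‖a‖ ^ 2 ≤ quad S a) (hM : S.det ≤ M) :
    S.trace ≤ k * (M / l ^ (k - 1)) := by
  have hP := posDef_of_le_quad hS hl h
  have hH := hP.1
  have hev : ∀ i, l ≤ hH.eigenvalues i := fun i => by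
    have h1 := h (hH.eigenvectorBasis i)
    have h2 : quad S (hH.eigenvectorBasis i) = hH.eigenvalues i := by
      rw [hH.eigenvalues_eq i]; simp [quad]
    rw [h2, hH.eigenvectorBasis.orthonormal.1 i] at h1
    simpa using h1
  rw [hH.trace_eq_sum_eigenvalues]
  rw [hH.det_eq_prod_eigenvalues] at hM
  simp only [RCLike.ofReal_real_eq_id, id] at hM ⊢
  have : ∀ i ∈ Finset.univ, hH.eigenvalues i ≤ M / l ^ (k - 1) := fun i hi => by
    rw [le_div_iff₀ (by positivity)]
    refine le_trans ?_ hM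
    rw [← Finset.mul_prod_erase _ _ hi]
    refine mul_le_mul_of_nonneg_left ?_ (hl.le.trans (hev i))
    have := Finset.prod_le_prod (s := Finset.univ.erase i) (f := fun _ => l)
      (g := hH.eigenvalues) (fun _ _ => hl.le) (fun j _ => hev j)
    simpa [Finset.card_erase_of_mem hi] using this
  simpa using Finset.sum_le_card_nsmul _ _ _ this

theorem diag_nonneg_of_posSemidef {S : Matrix (Fin k) (Fin k) ℝ} (hS : S.PosSemidef) (i : Fin k) :
    0 ≤ S i i := by
  simpa using hS.diag_nonneg (i := i)

theorem diag_le_trace {S : Matrix (Fin k) (Fin k) ℝ} (hS : S.PosSemidef) (i : Fin k) :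
    S i i ≤ S.trace :=
  Finset.single_le_sum (f := fun i => S i i) (fun j _ => diag_nonneg_of_posSemidef hS j)
    (Finset.mem_univ i)

theorem sq_apply_le_trace_mul_self {G : Matrix (Fin k) (Fin k) ℝ} (hG : G.IsSymm) (i j : Fin k) :
    (G i j) ^ 2 ≤ (G * G).trace := by
  have h1 : (G * G).trace = ∑ i, ∑ j, (G i j) ^ 2 := by
    simp only [Matrix.trace, Matrix.diag, Matrix.mul_apply]
    refine Finset.sum_congr rfl fun i _ => Finset.sum_congr rfl fun j _ => ?_
    rw [sq, hG.apply i j]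
  rw [h1]
  refine le_trans ?_ (Finset.single_le_sum (f := fun i => ∑ j, (G i j) ^ 2)
    (fun i _ => Finset.sum_nonneg fun j _ => sq_nonneg _) (Finset.mem_univ i))
  exact Finset.single_le_sum (f := fun j => (G i j) ^ 2) (fun j _ => sq_nonneg _)
    (Finset.mem_univ j)

theorem abs_apply_le_trace {S : Matrix (Fin k) (Fin k) ℝ} (hS : S.PosSemidef) (i j : Fin k) :
    |S i j| ≤ S.trace := by
  set G := (symSqrt S).mat with hG
  have hs : G.IsSymm := symSqrt_isSymm S
  have h := symSqrt_mul_self hS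
  have h1 : S i j ^ 2 ≤ S i i * S j j := by
    have e : ∀ a b, S a b = ∑ l, G a l * G b l := fun a b => by
      have h' : S a b = (G * G) a b := by rw [h]
      rw [h', Matrix.mul_apply]
      exact Finset.sum_congr rfl fun l _ => by rw [hs.apply b l]
    rw [e i j, e i i, e j j]
    have := Finset.sum_mul_sq_le_sq_mul_sq Finset.univ (fun l => G i l) (fun l => G j l)
    simpa [sq] using this
  have h2 := diag_le_trace hS i
  have h3 := diag_le_trace hS j
  have h4 := diag_nonneg_of_posSemidef hS i
  have h5 := diag_nonneg_of_posSemidef hS j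
  apply abs_le_of_sq_le_sq _ (h4.trans h2)
  nlinarith

theorem tendsto_matrix_inv {ι : Type*} {l : Filter ι} {S : ι → Matrix (Fin k) (Fin k) ℝ}
    {S₀ : Matrix (Fin k) (Fin k) ℝ} (h₀ : S₀.det ≠ 0) (h : Tendsto S l (𝓝 S₀)) :
    Tendsto (fun n => (S n)⁻¹) l (𝓝 S₀⁻¹) := by
  refine (continuousAt_matrix_inv S₀ ?_).tendsto.comp h
  simpa using continuousAt_inv₀ h₀

theorem tendsto_quad_inv {ι : Type*} {l : Filter ι} {S : ι → Matrix (Fin k) (Fin k) ℝ}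
    {S₀ : Matrix (Fin k) (Fin k) ℝ} (h₀ : S₀.det ≠ 0) (h : Tendsto S l (𝓝 S₀))
    {m : ι → Space k} {m₀ : Space k} (hm : Tendsto m l (𝓝 m₀)) (y : Space k) :
    Tendsto (fun n => quad (S n)⁻¹ (y - m n)) l (𝓝 (quad S₀⁻¹ (y - m₀))) := by
  have h1 : Tendsto (fun n => ((S n)⁻¹, y - m n)) l (𝓝 (S₀⁻¹, y - m₀)) :=
    (tendsto_matrix_inv h₀ h).prodMk_nhds (tendsto_const_nhds.sub hm)
  exact (continuous_quad_prod.tendsto _).comp h1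

/-! ### Moments of trimming functions -/

section Moments

variable {P : Measure (Space k)} [IsProbabilityMeasure P] {γ : ℝ} {φ : Space k → ℝ}

theorem integrable_of_mem_Icc (hm : Measurable φ) (h : ∀ y, φ y ∈ Set.Icc (0 : ℝ) 1) :
    Integrable φ P :=
  Integrable.of_bound hm.aestronglyMeasurable 1 (Eventually.of_forall fun y => by
    rw [Real.norm_of_nonneg (h y).1]; exact (h y).2)

theorem integrable_mul_of_growth (hφ : φ ∈ trimClass P γ) {f : Space k → ℝ} (hf : Continuous f)
    (K : ℝ) (h : ∀ y, |f y| ≤ K * (1 + ‖y‖ ^ 2)) : Integrable (fun y => f y * φ y) P := by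
  obtain ⟨h1, h2, -, h4⟩ := hφ
  have h5 : Integrable (fun y => K * (φ y + ‖y‖ ^ 2 * φ y)) P :=
    ((integrable_of_mem_Icc h1 h2).add h4).const_mul K
  refine h5.mono' (hf.measurable.mul h1).aestronglyMeasurable (Eventually.of_forall fun y => ?_)
  rw [Real.norm_eq_abs, abs_mul, abs_of_nonneg (h2 y).1]
  nlinarith [mul_le_mul_of_nonneg_right (h y) (h2 y).1]

theorem integrable_trim (hφ : φ ∈ trimClass P γ) : Integrable φ P :=
  integrable_of_mem_Icc hφ.1 hφ.2.1

theorem abs_apply_le_growth (y : Space k) (i : Fin k) : |y i| ≤ 1 * (1 + ‖y‖ ^ 2) := by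
  have := PiLp.norm_apply_le y i
  rw [Real.norm_eq_abs] at this
  nlinarith [sq_nonneg (‖y‖ - 1), norm_nonneg y]

theorem abs_apply_mul_le_growth (y : Space k) (i j : Fin k) :
    |y i * y j| ≤ 1 * (1 + ‖y‖ ^ 2) := by
  have h1 := PiLp.norm_apply_le y i
  have h2 := PiLp.norm_apply_le y j
  rw [Real.norm_eq_abs] at h1 h2
  rw [abs_mul]
  nlinarith [mul_le_mul h1 h2 (abs_nonneg _) (norm_nonneg y)]

theorem integrable_apply_mul (hφ : φ ∈ trimClass P γ) (i : Fin k) :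
    Integrable (fun y => y i * φ y) P :=
  integrable_mul_of_growth hφ (by fun_prop) 1 fun y => abs_apply_le_growth y i

theorem integrable_apply_mul_apply_mul (hφ : φ ∈ trimClass P γ) (i j : Fin k) :
    Integrable (fun y => y i * y j * φ y) P :=
  integrable_mul_of_growth hφ (by fun_prop) 1 fun y => abs_apply_mul_le_growth y i j

theorem integrable_smul_id (hφ : φ ∈ trimClass P γ) : Integrable (fun y => φ y • y) P := by
  have h : Integrable (fun y => ‖y‖ * φ y) P :=
    integrable_mul_of_growth hφ continuous_norm 1 fun y => by
      rw [abs_of_nonneg (norm_nonneg y)]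
      nlinarith [sq_nonneg (‖y‖ - 1), norm_nonneg y]
  refine h.mono' (hφ.1.smul measurable_id).aestronglyMeasurable (Eventually.of_forall fun y => ?_)
  rw [norm_smul, Real.norm_of_nonneg (hφ.2.1 y).1, mul_comm]

theorem trimMean_apply (hφ : φ ∈ trimClass P γ) (i : Fin k) :
    trimMean P φ i = (∫ y, φ y ∂P)⁻¹ * ∫ y, y i * φ y ∂P := by
  have h := (EuclideanSpace.proj (𝕜 := ℝ) i).integral_comp_comm (integrable_smul_id hφ)
  simp only [PiLp.proj_apply, PiLp.smul_apply, smul_eq_mul] at h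
  simp only [trimMean, PiLp.smul_apply, smul_eq_mul, ← h, mul_comm]

theorem integral_centered_expand (hφ : φ ∈ trimClass P γ) (m : Space k) (i j : Fin k) :
    ∫ y, (y i - m i) * (y j - m j) * φ y ∂P = (∫ y, y i * y j * φ y ∂P)
      - m j * (∫ y, y i * φ y ∂P) - m i * (∫ y, y j * φ y ∂P) + m i * m j * ∫ y, φ y ∂P := by
  have h1 := integrable_apply_mul_apply_mul hφ i j
  have h2 := (integrable_apply_mul hφ i).const_mul (m j)
  have h3 := (integrable_apply_mul hφ j).const_mul (m i)
  have h4 := (integrable_trim hφ).const_mul (m i * m j)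
  have e : ∀ y : Space k, (y i - m i) * (y j - m j) * φ y = y i * y j * φ y - m j * (y i * φ y)
      - m i * (y j * φ y) + m i * m j * φ y := fun y => by ring
  simp only [e]
  rw [integral_add, integral_sub, integral_sub]
  · simp only [integral_const_mul]
  · exact h1
  · exact h2
  · exact h1.sub h2
  · exact h3
  · exact (h1.sub h2).sub h3
  · exact h4

theorem integrable_centered (hφ : φ ∈ trimClass P γ) (m : Space k) (i j : Fin k) :
    Integrable (fun y => (y i - m i) * (y j - m j) * φ y) P := by
  have h1 := integrable_apply_mul_apply_mul hφ i j
  have h2 := (integrable_apply_mul hφ i).const_mul (m j)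
  have h3 := (integrable_apply_mul hφ j).const_mul (m i)
  have h4 := (integrable_trim hφ).const_mul (m i * m j)
  refine (((h1.sub h2).sub h3).add h4).congr (Eventually.of_forall fun y => ?_)
  simp only [Pi.sub_apply, Pi.add_apply]
  ring

theorem integral_trim_pos (hγ : 0 < γ) (hφ : φ ∈ trimClass P γ) : 0 < ∫ y, φ y ∂P :=
  hγ.trans_le hφ.2.2.1

theorem integral_trim_le_one (hφ : φ ∈ trimClass P γ) : ∫ y, φ y ∂P ≤ 1 := by
  have := integral_mono (integrable_trim hφ) (integrable_const (1 : ℝ)) fun y => (hφ.2.1 y).2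
  simpa using this

theorem trimCov_apply (hγ : 0 < γ) (hφ : φ ∈ trimClass P γ) (i j : Fin k) :
    trimCov P φ i j = (∫ y, φ y ∂P)⁻¹ * (∫ y, y i * y j * φ y ∂P)
      - trimMean P φ i * trimMean P φ j := by
  have h0 := (integral_trim_pos hγ hφ).ne'
  rw [trimCov, Matrix.of_apply, integral_centered_expand hφ, trimMean_apply hφ, trimMean_apply hφ]
  field_simp
  ring

theorem integral_centered (hγ : 0 < γ) (hφ : φ ∈ trimClass P γ) (m : Space k) (i j : Fin k) :
    ∫ y, (y i - m i) * (y j - m j) * φ y ∂P = (∫ y, φ y ∂P) * (trimCov P φ i j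
      + (trimMean P φ i - m i) * (trimMean P φ j - m j)) := by
  have h0 := (integral_trim_pos hγ hφ).ne'
  rw [integral_centered_expand hφ, trimCov_apply hγ hφ]
  simp only [trimMean_apply hφ]
  field_simp
  ring

theorem trimCov_isSymm (P : Measure (Space k)) (φ : Space k → ℝ) : (trimCov P φ).IsSymm := by
  ext i j
  simp only [trimCov, Matrix.transpose_apply, Matrix.of_apply]
  congr 2
  ext y
  ring

theorem integrable_quad_mul (hφ : φ ∈ trimClass P γ) (B : Matrix (Fin k) (Fin k) ℝ)
    (m : Space k) : Integrable (fun y => quad B (y - m) * φ y) P := by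
  have h : Integrable (fun y : Space k => ∑ i, ∑ j, B i j * ((y i - m i) * (y j - m j) * φ y)) P :=
    integrable_finsetSum _ fun i _ => integrable_finsetSum _ fun j _ =>
      (integrable_centered hφ m i j).const_mul _
  refine h.congr (Eventually.of_forall fun y => ?_)
  simp only [quad_eq_sum, Finset.sum_mul, PiLp.sub_apply, mul_assoc]

/-- Variance plus squared bias. Used with `B = a a'` (variance in a direction), `B = 1` (total
variance) and `B = C_P(φ)⁻¹` (concentration steps). -/
theorem integral_quad_mul (hγ : 0 < γ) (hφ : φ ∈ trimClass P γ) (B : Matrix (Fin k) (Fin k) ℝ)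
    (m : Space k) : ∫ y, quad B (y - m) * φ y ∂P =
      (∫ y, φ y ∂P) * ((B * trimCov P φ).trace + quad B (trimMean P φ - m)) := by
  have h : ∀ y, quad B (y - m) * φ y = ∑ i, ∑ j, B i j * ((y i - m i) * (y j - m j) * φ y) := by
    intro y
    simp only [quad_eq_sum, Finset.sum_mul, PiLp.sub_apply, mul_assoc]
  simp only [h]
  refine (integral_finsetSum _ fun i _ => integrable_finsetSum _ fun j _ =>
      (integrable_centered hφ m i j).const_mul _).trans ?_
  have h2 : ∀ i, ∫ y, ∑ j, B i j * ((y i - m i) * (y j - m j) * φ y) ∂P =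
      ∑ j, B i j * ((∫ y, φ y ∂P) * (trimCov P φ i j
      + (trimMean P φ i - m i) * (trimMean P φ j - m j))) := by
    intro i
    refine (integral_finsetSum _ fun j _ => (integrable_centered hφ m i j).const_mul _).trans ?_
    simp only [integral_const_mul, integral_centered hγ hφ]
  simp only [h2, quad_eq_sum, Matrix.trace, Matrix.diag, Matrix.mul_apply, ← Finset.sum_add_distrib,
    Finset.mul_sum]
  refine Finset.sum_congr rfl fun i _ => Finset.sum_congr rfl fun j _ => ?_
  rw [(trimCov_isSymm P φ).apply i j]
  simp only [PiLp.sub_apply]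
  ring

theorem integral_inner_sq_mul (hγ : 0 < γ) (hφ : φ ∈ trimClass P γ) (a : Space k) :
    ∫ y, (inner ℝ a (y - trimMean P φ)) ^ 2 * φ y ∂P =
      (∫ y, φ y ∂P) * quad (trimCov P φ) a := by
  have h := integral_quad_mul hγ hφ (Matrix.vecMulVec a.ofLp a.ofLp) (trimMean P φ)
  simpa only [quad_vecMulVec_self, trace_vecMulVec_self_mul, sub_self, inner_zero_right, ne_eq,
    OfNat.ofNat_ne_zero, not_false_eq_true, zero_pow, add_zero] using h

theorem integral_norm_sq_mul (hγ : 0 < γ) (hφ : φ ∈ trimClass P γ) :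
    ∫ y, ‖y - trimMean P φ‖ ^ 2 * φ y ∂P = (∫ y, φ y ∂P) * (trimCov P φ).trace := by
  have h := integral_quad_mul hγ hφ 1 (trimMean P φ)
  simpa [quad_one] using h

theorem quad_trimCov_nonneg (hγ : 0 < γ) (hφ : φ ∈ trimClass P γ) (a : Space k) :
    0 ≤ quad (trimCov P φ) a := by
  have h := integral_inner_sq_mul hγ hφ a
  have h1 : 0 ≤ ∫ y, (inner ℝ a (y - trimMean P φ)) ^ 2 * φ y ∂P :=
    integral_nonneg fun y => mul_nonneg (sq_nonneg _) (hφ.2.1 y).1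
  rw [h] at h1
  exact nonneg_of_mul_nonneg_right h1 (integral_trim_pos hγ hφ)

theorem trimCov_posSemidef (hγ : 0 < γ) (hφ : φ ∈ trimClass P γ) : (trimCov P φ).PosSemidef := by
  refine Matrix.PosSemidef.of_dotProduct_mulVec_nonneg
    (Matrix.isHermitian_iff_isSymm.2 (trimCov_isSymm P φ)) fun x => ?_
  simpa [quad] using quad_trimCov_nonneg hγ hφ (WithLp.toLp 2 x)

/-- If slabs of half-width `δ` have mass at most `γ - τ`, the trimmed covariances are bounded
below. -/
theorem le_quad_trimCov (hγ : 0 < γ) (hφ : φ ∈ trimClass P γ) {δ τ : ℝ} (hδ : 0 ≤ δ)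
    (h : ∀ a : Space k, ‖a‖ = 1 → ∀ b : ℝ, P.real {y | |inner ℝ a y - b| ≤ δ} ≤ γ - τ)
    (a : Space k) : δ ^ 2 * τ * ‖a‖ ^ 2 ≤ quad (trimCov P φ) a := by
  have key : ∀ a : Space k, ‖a‖ = 1 → δ ^ 2 * τ ≤ quad (trimCov P φ) a := by
    intro a ha
    have h1 := integral_inner_sq_mul hγ hφ a
    set T := trimMean P φ
    set A : Set (Space k) := {y | |inner ℝ a y - inner ℝ a T| ≤ δ} with hA
    have hAm : MeasurableSet A := by
      refine measurableSet_le ?_ measurable_const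
      exact (Continuous.abs (by fun_prop)).measurable
    have hI : Integrable (fun y => (inner ℝ a (y - T)) ^ 2 * φ y) P := by
      simpa only [quad_vecMulVec_self] using
        integrable_quad_mul hφ (Matrix.vecMulVec a.ofLp a.ofLp) T
    -- Off the slab the squared inner product is at least `δ²`; on it the left integrand is
    -- nonpositive. The left side is at least `δ² τ`, since `φ` has mass at least `γ` and the slab
    -- at most `γ - τ`.
    have h2 : ∫ y, δ ^ 2 * (φ y - A.indicator 1 y) ∂P ≤
        ∫ y, (inner ℝ a (y - T)) ^ 2 * φ y ∂P := by
      refine integral_mono (((integrable_trim hφ).sub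
        ((integrable_const 1).indicator hAm)).const_mul _) hI fun y => ?_
      have hy := hφ.2.1 y
      by_cases hyA : y ∈ A
      · simp only [Set.indicator_of_mem hyA, Pi.one_apply]
        have : δ ^ 2 * (φ y - 1) ≤ 0 := mul_nonpos_of_nonneg_of_nonpos (sq_nonneg _)
          (by linarith [hy.2])
        exact this.trans (mul_nonneg (sq_nonneg _) hy.1)
      · simp only [Set.indicator_of_notMem hyA, sub_zero]
        refine mul_le_mul_of_nonneg_right ?_ hy.1
        rw [hA, Set.mem_ofPred_eq, not_le, ← inner_sub_right] at hyA
        rw [← sq_abs (inner ℝ a (y - T))]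
        exact pow_le_pow_left₀ hδ hyA.le 2
    have hA1 : Integrable (A.indicator (1 : Space k → ℝ)) P := (integrable_const 1).indicator hAm
    rw [integral_const_mul, integral_sub (integrable_trim hφ) hA1, integral_indicator_one hAm,
      h1] at h2
    have h3 := h a ha (inner ℝ a T)
    have h4 := integral_trim_le_one hφ
    have h5 := quad_trimCov_nonneg hγ hφ a
    have h6 := hφ.2.2.1
    have h7 : δ ^ 2 * τ ≤ δ ^ 2 * ((∫ y, φ y ∂P) - P.real A) :=
      mul_le_mul_of_nonneg_left (by linarith) (sq_nonneg _)
    nlinarith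
  rcases eq_or_ne a 0 with rfl | ha
  · simp [quad]
  · have hn : ‖a‖ ≠ 0 := norm_ne_zero_iff.2 ha
    have h1 := key (‖a‖⁻¹ • a) (by rw [norm_smul, norm_inv, norm_norm, inv_mul_cancel₀ hn])
    rw [quad_smul, inv_pow, inv_mul_eq_div, le_div_iff₀ (by positivity)] at h1
    exact h1

theorem mem_trimClass_of_support {R : ℝ} (hm : Measurable φ)
    (h01 : ∀ y, φ y ∈ Set.Icc (0 : ℝ) 1) (hs : ∀ y, φ y ≠ 0 → ‖y‖ ≤ R)
    (hγ : γ ≤ ∫ y, φ y ∂P) : φ ∈ trimClass P γ := by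
  refine ⟨hm, h01, hγ, Integrable.of_bound
    ((continuous_norm.measurable.pow_const 2).mul hm).aestronglyMeasurable (R ^ 2)
    (Eventually.of_forall fun y => ?_)⟩
  by_cases hy : φ y = 0
  · simp [hy, sq_nonneg]
  · rw [norm_mul, norm_pow, norm_norm, Real.norm_of_nonneg (h01 y).1]
    have := pow_le_pow_left₀ (norm_nonneg y) (hs y hy) 2
    nlinarith [(h01 y).2, (h01 y).1, sq_nonneg ‖y‖, sq_nonneg R]

end Moments

/-! ### Radii and ellipsoids -/

theorem mem_ellipsoid {m : Space k} {S : Matrix (Fin k) (Fin k) ℝ} {s : ℝ} {y : Space k} :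
    y ∈ ellipsoid m S s ↔ quad S⁻¹ (y - m) ≤ s ^ 2 := Iff.rfl

/-- The estimate `t ≤ 1 + t²` keeps square roots out of the bound. -/
theorem norm_le_of_quad_inv_le {S : Matrix (Fin k) (Fin k) ℝ} (hS : S.PosDef) {m y : Space k}
    {s : ℝ} (h : quad S⁻¹ (y - m) ≤ s) : ‖y‖ ≤ ‖m‖ + (1 + S.trace * s) := by
  have h1 := norm_sq_le_trace_mul_quad_inv hS (y - m)
  have h2 : S.trace * quad S⁻¹ (y - m) ≤ S.trace * s :=
    mul_le_mul_of_nonneg_left h hS.posSemidef.trace_nonneg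
  have h3 : ‖y‖ ≤ ‖m‖ + ‖y - m‖ := by
    simpa using norm_add_le m (y - m)
  nlinarith [sq_nonneg (‖y - m‖ - 1)]

/-- Moving a point of the level set radially away from `m` leaves the ellipsoid at once, because `s
> 0`. -/
theorem setOf_quad_eq_subset_frontier {S : Matrix (Fin k) (Fin k) ℝ} (m : Space k) {s : ℝ}
    (hs : 0 < s) : {y | quad S⁻¹ (y - m) = s ^ 2} ⊆ frontier (ellipsoid m S s) := by
  intro y hy
  have hy' : quad S⁻¹ (y - m) = s ^ 2 := hy
  rw [frontier_eq_closure_inter_closure]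
  refine ⟨subset_closure (mem_ellipsoid.2 hy'.le), ?_⟩
  have ht : Tendsto (fun t : ℝ => m + t • (y - m)) (𝓝[>] 1) (𝓝 (m + (1 : ℝ) • (y - m))) :=
    (Continuous.tendsto (by fun_prop) 1).mono_left nhdsWithin_le_nhds
  rw [one_smul, add_sub_cancel] at ht
  refine mem_closure_of_tendsto ht ?_
  filter_upwards [self_mem_nhdsWithin] with t ht1
  have ht1' : (1 : ℝ) < t := ht1
  rw [Set.mem_compl_iff, mem_ellipsoid, add_sub_cancel_left, quad_smul, hy', not_le]
  exact lt_mul_of_one_lt_left (pow_pos hs 2) (one_lt_pow₀ ht1' two_ne_zero)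

section Radius

variable {P : Measure (Space k)} [IsProbabilityMeasure P] {γ : ℝ} {q : Space k → ℝ}

theorem exists_mass_ge (hγ : γ < 1) :
    ∃ s : ℝ, 0 < s ∧ γ ≤ P.real {y | q y ≤ s ^ 2} := by
  have h : Tendsto (fun n : ℕ => P.real {y | q y ≤ (n : ℝ) ^ 2}) atTop (𝓝 1) := by
    have hm : Monotone fun n : ℕ => {y | q y ≤ (n : ℝ) ^ 2} := by
      intro a b hab y hy
      have : (a : ℝ) ≤ b := by exact_mod_cast hab
      exact le_trans (show q y ≤ _ from hy) (pow_le_pow_left₀ (Nat.cast_nonneg _) this 2)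
    have h1 := tendsto_measure_iUnion_atTop (μ := P) hm
    have h2 : (⋃ n : ℕ, {y | q y ≤ (n : ℝ) ^ 2}) = Set.univ := by
      refine Set.eq_univ_of_forall fun y => Set.mem_iUnion.2 ?_
      obtain ⟨n, hn⟩ := exists_nat_ge (q y)
      refine ⟨n + 1, ?_⟩
      simp only [Set.mem_ofPred_eq, Nat.cast_add, Nat.cast_one]
      nlinarith [Nat.cast_nonneg (α := ℝ) n]
    rw [h2, measure_univ] at h1
    have := (ENNReal.tendsto_toReal ENNReal.one_ne_top).comp h1
    simpa [Function.comp_def, Measure.real] using this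
  obtain ⟨n, hn, hn0⟩ := ((h.eventually (lt_mem_nhds hγ)).and (eventually_gt_atTop 0)).exists
  exact ⟨n, by exact_mod_cast hn0, hn.le⟩

theorem mass_mono {s t : ℝ} (hs : 0 ≤ s) (hst : s ≤ t) :
    P.real {y | q y ≤ s ^ 2} ≤ P.real {y | q y ≤ t ^ 2} :=
  measureReal_mono fun _ hy => le_trans hy (pow_le_pow_left₀ hs hst 2)

theorem sInf_mass_nonneg : 0 ≤ sInf {s : ℝ | 0 < s ∧ γ ≤ P.real {y | q y ≤ s ^ 2}} :=
  Real.sInf_nonneg fun _ hs => hs.1.le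

/-- Continuity of the measure from above, along radii decreasing to the infimum; `γ < 1` makes the
set of admissible radii nonempty. -/
theorem le_mass_sInf (hq : Measurable q) (hγ : γ < 1) :
    γ ≤ P.real {y | q y ≤ (sInf {s : ℝ | 0 < s ∧ γ ≤ P.real {y | q y ≤ s ^ 2}}) ^ 2} := by
  set r := sInf {s : ℝ | 0 < s ∧ γ ≤ P.real {y | q y ≤ s ^ 2}} with hr
  have hr0 : 0 ≤ r := sInf_mass_nonneg
  have hne : {s : ℝ | 0 < s ∧ γ ≤ P.real {y | q y ≤ s ^ 2}}.Nonempty := exists_mass_ge hγ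
  have hle : ∀ t, r < t → γ ≤ P.real {y | q y ≤ t ^ 2} := by
    intro t ht
    obtain ⟨s, hs, hst⟩ := exists_lt_of_csInf_lt hne ht
    exact hs.2.trans (mass_mono hs.1.le hst.le)
  set u : ℕ → ℝ := fun n => r + 1 / ((n : ℝ) + 1) with hu
  have hul : Tendsto u atTop (𝓝 r) := by
    simpa [hu] using (tendsto_const_nhds (x := r)).add tendsto_one_div_add_atTop_nhds_zero_nat
  have hur : ∀ n, r < u n := fun n => by
    have : (0 : ℝ) < 1 / ((n : ℝ) + 1) := by positivity
    simp only [hu]; linarith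
  have hanti : Antitone fun n => {y | q y ≤ (u n) ^ 2} := by
    intro a b hab y hy
    refine le_trans (show q y ≤ _ from hy) (pow_le_pow_left₀ (hr0.trans (hur b).le) ?_ 2)
    simp only [hu]
    gcongr
  have h1 := tendsto_measure_iInter_atTop (μ := P)
    (fun n => (measurableSet_le hq measurable_const).nullMeasurableSet) hanti
    ⟨0, measure_ne_top P _⟩
  have h2 : (⋂ n, {y | q y ≤ (u n) ^ 2}) = {y | q y ≤ r ^ 2} := by
    ext y
    simp only [Set.mem_iInter, Set.mem_ofPred_eq]
    refine ⟨fun h => ge_of_tendsto' (hul.pow 2) h, fun h n =>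
      h.trans (pow_le_pow_left₀ hr0 (hur n).le 2)⟩
  rw [h2] at h1
  have h3 := (ENNReal.tendsto_toReal (measure_ne_top P _)).comp h1
  exact ge_of_tendsto' h3 fun n => hle _ (hur n)

theorem mass_lt_sInf_le (hq0 : ∀ y, 0 ≤ q y) (hγ : 0 ≤ γ) :
    P.real {y | q y < (sInf {s : ℝ | 0 < s ∧ γ ≤ P.real {y | q y ≤ s ^ 2}}) ^ 2} ≤ γ := by
  set r := sInf {s : ℝ | 0 < s ∧ γ ≤ P.real {y | q y ≤ s ^ 2}} with hr
  have hr0 : 0 ≤ r := sInf_mass_nonneg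
  rcases hr0.eq_or_lt with h0 | h0
  · have : {y | q y < r ^ 2} = ∅ := by
      ext y
      simp [← h0, hq0 y]
    rw [this]
    simpa using hγ
  have hlt : ∀ s, 0 < s → s < r → P.real {y | q y ≤ s ^ 2} ≤ γ := by
    intro s hs hsr
    by_contra hcon
    exact absurd (csInf_le ⟨0, fun _ h => h.1.le⟩ (show s ∈ {s : ℝ | 0 < s ∧ γ ≤
      P.real {y | q y ≤ s ^ 2}} from ⟨hs, (not_le.1 hcon).le⟩)) (not_le.2 hsr)
  -- The `+ 2` keeps every `u n` strictly positive, as membership in the set defining `r` requires.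
  set u : ℕ → ℝ := fun n => r - r / ((n : ℝ) + 2) with hu
  have hul : Tendsto u atTop (𝓝 r) := by
    have h1 : Tendsto (fun n : ℕ => r / ((n : ℝ) + 2)) atTop (𝓝 0) :=
      tendsto_const_nhds.div_atTop (tendsto_natCast_atTop_atTop.atTop_add tendsto_const_nhds)
    simpa using (tendsto_const_nhds (x := r)).sub h1
  have hu0 : ∀ n, 0 < u n ∧ u n < r := fun n => by
    have h2 : (0 : ℝ) < (n : ℝ) + 2 := by positivity
    have h3 : r / ((n : ℝ) + 2) < r := div_lt_self h0 (by linarith [Nat.cast_nonneg (α := ℝ) n])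
    have h4 : 0 < r / ((n : ℝ) + 2) := by positivity
    simp only [hu]; constructor <;> linarith
  have hmono : Monotone fun n => {y | q y ≤ (u n) ^ 2} := by
    intro a b hab y hy
    refine le_trans (show q y ≤ _ from hy) (pow_le_pow_left₀ (hu0 a).1.le ?_ 2)
    simp only [hu]
    gcongr
  have h1 := tendsto_measure_iUnion_atTop (μ := P) hmono
  have h2 : (⋃ n, {y | q y ≤ (u n) ^ 2}) = {y | q y < r ^ 2} := by
    ext y
    simp only [Set.mem_iUnion, Set.mem_ofPred_eq]
    refine ⟨fun ⟨n, h⟩ => h.trans_lt (pow_lt_pow_left₀ (hu0 n).2 (hu0 n).1.le two_ne_zero), fun h => ?_⟩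
    obtain ⟨n, hn⟩ := ((hul.pow 2).eventually (lt_mem_nhds h)).exists
    exact ⟨n, hn.le⟩
  rw [h2] at h1
  have h3 := (ENNReal.tendsto_toReal (measure_ne_top P _)).comp h1
  exact le_of_tendsto' h3 fun n => hlt _ (hu0 n).1 (hu0 n).2

/-! ### Concentration steps -/

/-- The trimming function that is `1` for `q < r²`, `0` for `q > r²` and constant for `q = r²`, with
the constant for which its integral is `γ`. -/
noncomputable def levelTrim (P : Measure (Space k)) (γ : ℝ) (q : Space k → ℝ) (r : ℝ) :
    Space k → ℝ :=
  fun y => {y | q y < r ^ 2}.indicator 1 y + ((γ - P.real {y | q y < r ^ 2}) /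
    P.real {y | q y = r ^ 2}) * {y | q y = r ^ 2}.indicator 1 y

theorem mass_le_eq_add (hq : Measurable q) (r : ℝ) :
    P.real {y | q y ≤ r ^ 2} = P.real {y | q y < r ^ 2} + P.real {y | q y = r ^ 2} := by
  rw [← measureReal_union _ (measurableSet_eq_fun hq measurable_const)]
  · congr 1
    ext y
    simp [le_iff_lt_or_eq]
  · rw [Set.disjoint_left]
    intro y h1 h2
    exact (show q y < r ^ 2 from h1).ne h2

theorem measurable_levelTrim (hq : Measurable q) (r : ℝ) : Measurable (levelTrim P γ q r) :=
  (measurable_one.indicator (measurableSet_lt hq measurable_const)).add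
    ((measurable_one.indicator (measurableSet_eq_fun hq measurable_const)).const_mul _)

theorem levelTrim_of_lt {r : ℝ} {y : Space k} (h : q y < r ^ 2) : levelTrim P γ q r y = 1 := by
  simp [levelTrim, h, h.ne]

theorem levelTrim_of_gt {r : ℝ} {y : Space k} (h : r ^ 2 < q y) : levelTrim P γ q r y = 0 := by
  simp [levelTrim, h.ne', h.le]

theorem levelTrim_mem_Icc (hq : Measurable q) {r : ℝ} (h1 : P.real {y | q y < r ^ 2} ≤ γ)
    (h2 : γ ≤ P.real {y | q y ≤ r ^ 2}) (y : Space k) :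
    levelTrim P γ q r y ∈ Set.Icc (0 : ℝ) 1 := by
  rcases lt_trichotomy (q y) (r ^ 2) with h | h | h
  · rw [levelTrim_of_lt h]; simp
  · rw [mass_le_eq_add hq] at h2
    simp only [levelTrim, Set.indicator, Set.mem_ofPred_eq, h, lt_irrefl, if_false, if_true,
      Pi.one_apply, zero_add, mul_one]
    exact ⟨div_nonneg (by linarith) measureReal_nonneg,
      div_le_one_of_le₀ (by linarith) measureReal_nonneg⟩
  · rw [levelTrim_of_gt h]; simp

theorem integral_levelTrim (hq : Measurable q) {r : ℝ} (h1 : P.real {y | q y < r ^ 2} ≤ γ)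
    (h2 : γ ≤ P.real {y | q y ≤ r ^ 2}) : ∫ y, levelTrim P γ q r y ∂P = γ := by
  have m1 : MeasurableSet {y | q y < r ^ 2} := measurableSet_lt hq measurable_const
  have m2 : MeasurableSet {y | q y = r ^ 2} := measurableSet_eq_fun hq measurable_const
  simp only [levelTrim]
  rw [integral_add ((integrable_const 1).indicator m1)
    (((integrable_const 1).indicator m2).const_mul _), integral_const_mul,
    integral_indicator_one m1, integral_indicator_one m2]
  rw [mass_le_eq_add hq] at h2
  -- On a null level set the weight is a division by zero, hence `0`; then `h1` and `h2` already
  -- force `{q < r²}` to have mass `γ`.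
  by_cases h0 : P.real {y | q y = r ^ 2} = 0
  · rw [h0] at h2 ⊢
    simp; linarith
  · field_simp
    ring

end Radius

section Concentration

variable {P : Measure (Space k)} [IsProbabilityMeasure P] {γ : ℝ} {φ ψ : Space k → ℝ}

/-- The squared distance of `y` from `T_P(φ)` in the metric of `C_P(φ)`. -/
noncomputable def trimDist (P : Measure (Space k)) (φ : Space k → ℝ) (y : Space k) : ℝ :=
  quad (trimCov P φ)⁻¹ (y - trimMean P φ)

theorem continuous_trimDist (P : Measure (Space k)) (φ : Space k → ℝ) :
    Continuous (trimDist P φ) :=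
  (continuous_quad _).comp (by fun_prop)

theorem trimDist_nonneg (hC : (trimCov P φ).PosDef) (y : Space k) : 0 ≤ trimDist P φ y :=
  quad_nonneg hC.inv.posSemidef _

theorem trimRadius_nonneg : 0 ≤ trimRadius P γ φ := sInf_mass_nonneg (q := trimDist P φ)

theorem le_mass_trimRadius (hγ1 : γ < 1) :
    γ ≤ P.real {y | trimDist P φ y ≤ (trimRadius P γ φ) ^ 2} :=
  le_mass_sInf (continuous_trimDist P φ).measurable hγ1

theorem mass_lt_trimRadius_le (hγ : 0 < γ) (hC : (trimCov P φ).PosDef) :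
    P.real {y | trimDist P φ y < (trimRadius P γ φ) ^ 2} ≤ γ :=
  mass_lt_sInf_le (q := trimDist P φ) (trimDist_nonneg hC) hγ.le

theorem trimRadius_le {s : ℝ} (hs : 0 < s) (h : γ ≤ P.real {y | trimDist P φ y ≤ s ^ 2}) :
    trimRadius P γ φ ≤ s :=
  csInf_le ⟨0, fun _ h => h.1.le⟩ ⟨hs, h⟩

/-- `ψ` is a trimming function concentrated on the ellipsoid that belongs to `φ`. -/
structure IsStep (P : Measure (Space k)) (γ : ℝ) (φ ψ : Space k → ℝ) : Prop where
  mem : ψ ∈ trimClass P γ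
  integral_eq : ∫ y, ψ y ∂P = γ
  eq_one : ∀ᵐ y ∂P, trimDist P φ y < (trimRadius P γ φ) ^ 2 → ψ y = 1
  eq_zero : ∀ᵐ y ∂P, (trimRadius P γ φ) ^ 2 < trimDist P φ y → ψ y = 0

theorem exists_isStep (hγ : 0 < γ) (hγ1 : γ < 1) (hC : (trimCov P φ).PosDef) :
    ∃ ψ, IsStep P γ φ ψ := by
  have hq := (continuous_trimDist P φ).measurable
  have h1 := mass_lt_trimRadius_le (P := P) (φ := φ) hγ hC
  have h2 := le_mass_trimRadius (P := P) (φ := φ) hγ1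
  have h3 := integral_levelTrim hq h1 h2
  refine ⟨levelTrim P γ (trimDist P φ) (trimRadius P γ φ), ?_, h3,
    Eventually.of_forall fun y h => levelTrim_of_lt h,
    Eventually.of_forall fun y h => levelTrim_of_gt h⟩
  refine mem_trimClass_of_support (measurable_levelTrim hq _) (levelTrim_mem_Icc hq h1 h2)
    (R := ‖trimMean P φ‖ + (1 + (trimCov P φ).trace * trimRadius P γ φ ^ 2))
    (fun y hy => norm_le_of_quad_inv_le hC ?_) h3.ge
  by_contra hcon
  exact hy (levelTrim_of_gt (not_le.1 hcon))

/-- The pointwise Neyman–Pearson inequality: both factors have the same sign, since `ψ` is `1`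
inside and `0` outside while `φ` takes values in `[0, 1]`. -/
theorem IsStep.mul_le_mul (h : IsStep P γ φ ψ) (hφ : φ ∈ trimClass P γ) :
    ∀ᵐ y ∂P, 0 ≤ (trimDist P φ y - (trimRadius P γ φ) ^ 2) * (φ y - ψ y) := by
  filter_upwards [h.eq_one, h.eq_zero] with y h1 h2
  rcases lt_trichotomy (trimDist P φ y) ((trimRadius P γ φ) ^ 2) with hy | hy | hy
  · rw [h1 hy]
    exact mul_nonneg_of_nonpos_of_nonpos (by linarith) (by linarith [(hφ.2.1 y).2])
  · rw [hy]; simp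
  · rw [h2 hy]
    exact mul_nonneg (by linarith) (by linarith [(hφ.2.1 y).1])

theorem integrable_trimDist_mul (hψ : ψ ∈ trimClass P γ) (c : ℝ) :
    Integrable (fun y => (trimDist P φ y - c) * ψ y) P := by
  have := (integrable_quad_mul hψ (trimCov P φ)⁻¹ (trimMean P φ)).sub
    ((integrable_trim hψ).const_mul c)
  refine this.congr (Eventually.of_forall fun y => ?_)
  simp only [Pi.sub_apply, trimDist]
  ring

theorem integral_trimDist_sub_mul (hγ : 0 < γ) (hψ : ψ ∈ trimClass P γ) (c : ℝ) :
    ∫ y, (trimDist P φ y - c) * ψ y ∂P = (∫ y, ψ y ∂P) *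
      (((trimCov P φ)⁻¹ * trimCov P ψ).trace
        + quad (trimCov P φ)⁻¹ (trimMean P ψ - trimMean P φ) - c) := by
  have h := integral_quad_mul hγ hψ (trimCov P φ)⁻¹ (trimMean P φ)
  simp only [sub_mul, trimDist]
  rw [integral_sub (integrable_quad_mul hψ (trimCov P φ)⁻¹ (trimMean P φ))
    ((integrable_trim hψ).const_mul c), integral_const_mul, h]
  ring

theorem trace_inv_mul_self {S : Matrix (Fin k) (Fin k) ℝ} (hS : S.PosDef) :
    (S⁻¹ * S).trace = k := by
  rw [Matrix.nonsing_inv_mul _ (isUnit_iff_ne_zero.2 hS.det_pos.ne')]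
  simp

theorem IsStep.integral_nonpos (h : IsStep P γ φ ψ) :
    ∫ y, (trimDist P φ y - (trimRadius P γ φ) ^ 2) * ψ y ∂P ≤ 0 := by
  refine integral_nonpos_of_ae ?_
  filter_upwards [h.eq_zero] with y h1
  rcases le_or_gt (trimDist P φ y) ((trimRadius P γ φ) ^ 2) with hy | hy
  · exact mul_nonpos_of_nonpos_of_nonneg (by linarith) (h.mem.2.1 y).1
  · simp [h1 hy]

theorem IsStep.integral_le (h : IsStep P γ φ ψ) (hφ : φ ∈ trimClass P γ) :
    ∫ y, (trimDist P φ y - (trimRadius P γ φ) ^ 2) * ψ y ∂P ≤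
      ∫ y, (trimDist P φ y - (trimRadius P γ φ) ^ 2) * φ y ∂P := by
  refine integral_mono_ae (integrable_trimDist_mul h.mem _) (integrable_trimDist_mul hφ _) ?_
  filter_upwards [h.mul_le_mul hφ] with y hy
  linarith

theorem IsStep.det_le (hγ : 0 < γ) (h : IsStep P γ φ ψ) (hφ : φ ∈ trimClass P γ)
    (hC : (trimCov P φ).PosDef) : (trimCov P ψ).det ≤ (trimCov P φ).det := by
  have h1 := h.integral_nonpos
  have h2 := h.integral_le hφ
  have h3 := det_le_det_mul_exp hC (trimCov_posSemidef hγ h.mem)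
  rw [integral_trimDist_sub_mul hγ h.mem, h.integral_eq] at h1 h2
  rw [integral_trimDist_sub_mul hγ hφ, trace_inv_mul_self hC] at h2
  have h4 := quad_nonneg hC.inv.posSemidef (trimMean P ψ - trimMean P φ)
  have h5 : quad (trimCov P φ)⁻¹ (trimMean P φ - trimMean P φ) = 0 := by simp [quad]
  rw [h5] at h2
  have h6 := hφ.2.2.1
  -- If the trace exceeded `k`, then `h1` would give `r² ≥ k`; the factor `∫ φ ≥ γ` in `h2` could
  -- then be lowered to `γ`, and `h2` would bound the trace by `k` after all.
  have h7 : ((trimCov P φ)⁻¹ * trimCov P ψ).trace ≤ k := by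
    by_contra hcon
    push Not at hcon
    have h8 : 0 ≤ trimRadius P γ φ ^ 2 - k := by nlinarith
    nlinarith
  refine h3.trans ?_
  have : Real.exp (((trimCov P φ)⁻¹ * trimCov P ψ).trace - k) ≤ 1 :=
    Real.exp_le_one_iff.2 (by linarith)
  nlinarith [hC.det_pos]

/-- A minimizing trimming function is concentrated on its own ellipsoid. -/
theorem IsMinimizing.isStep (hγ : 0 < γ) (hγ1 : γ < 1) (h : IsMinimizing P γ φ)
    (hC : (trimCov P φ).PosDef)
    (hb : P.real {y | trimDist P φ y = (trimRadius P γ φ) ^ 2} < γ) : IsStep P γ φ φ := by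
  obtain ⟨ψ, hψ⟩ := exists_isStep hγ hγ1 hC
  have hφ := h.1
  have h1 := hψ.integral_nonpos
  have h2 := hψ.integral_le hφ
  have h3 := det_le_det_mul_exp hC (trimCov_posSemidef hγ hψ.mem)
  have h3' := h.2 ψ hψ.mem
  have hq := (continuous_trimDist P φ).measurable
  -- A vanishing integral would make the open ellipsoid null, so the boundary would carry mass at
  -- least `γ`, contrary to `hb`.
  have hneg : ∫ y, (trimDist P φ y - (trimRadius P γ φ) ^ 2) * ψ y ∂P ≠ 0 := by
    intro h0
    have h4 : (fun y => -((trimDist P φ y - (trimRadius P γ φ) ^ 2) * ψ y)) =ᵐ[P] 0 := by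
      refine (integral_eq_zero_iff_of_nonneg_ae ?_ (integrable_trimDist_mul hψ.mem _).neg).1 ?_
      · filter_upwards [hψ.eq_zero] with y h1
        rcases le_or_gt (trimDist P φ y) ((trimRadius P γ φ) ^ 2) with hy | hy
        · exact neg_nonneg.2
            (mul_nonpos_of_nonpos_of_nonneg (by linarith) (hψ.mem.2.1 y).1)
        · simp [h1 hy]
      · change ∫ y, -((trimDist P φ y - (trimRadius P γ φ) ^ 2) * ψ y) ∂P = 0
        rw [integral_neg, h0, neg_zero]
    have h5 : P {y | trimDist P φ y < (trimRadius P γ φ) ^ 2} = 0 := by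
      rw [measure_eq_zero_iff_ae_notMem]
      filter_upwards [h4, hψ.eq_one] with y h4 h5 h6
      have h6' : trimDist P φ y < (trimRadius P γ φ) ^ 2 := h6
      rw [h5 h6'] at h4
      simp only [Pi.zero_apply, mul_one] at h4
      linarith
    have h6 := le_mass_trimRadius (P := P) (φ := φ) hγ1
    rw [mass_le_eq_add hq, Measure.real, h5] at h6
    simp only [ENNReal.toReal_zero, zero_add] at h6
    linarith
  have e1 := integral_trimDist_sub_mul (φ := φ) hγ hψ.mem (trimRadius P γ φ ^ 2)
  have e2 := integral_trimDist_sub_mul (φ := φ) hγ hφ (trimRadius P γ φ ^ 2)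
  rw [hψ.integral_eq] at e1
  have h5 : quad (trimCov P φ)⁻¹ (trimMean P φ - trimMean P φ) = 0 := by simp [quad]
  rw [trace_inv_mul_self hC, h5] at e2
  have h4 := quad_nonneg hC.inv.posSemidef (trimMean P ψ - trimMean P φ)
  have h6 := hφ.2.2.1
  -- A trace below `k` would make `det C_P(ψ)` strictly smaller than the minimum.
  have h7 : (k : ℝ) ≤ ((trimCov P φ)⁻¹ * trimCov P ψ).trace := by
    by_contra hcon
    push Not at hcon
    have : Real.exp (((trimCov P φ)⁻¹ * trimCov P ψ).trace - k) < 1 :=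
      (Real.exp_lt_exp.2 (by linarith)).trans_eq Real.exp_zero
    nlinarith [hC.det_pos]
  set A := ∫ y, (trimDist P φ y - (trimRadius P γ φ) ^ 2) * ψ y ∂P with hA
  set B := ∫ y, (trimDist P φ y - (trimRadius P γ φ) ^ 2) * φ y ∂P with hB
  have hA0 : A < 0 := lt_of_le_of_ne h1 hneg
  have hγA : γ * ((k : ℝ) + 0 - trimRadius P γ φ ^ 2) ≤ A := by
    rw [e1]; exact mul_le_mul_of_nonneg_left (by linarith) hγ.le
  have hk : (k : ℝ) + 0 - trimRadius P γ φ ^ 2 < 0 := by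
    by_contra hcon
    push Not at hcon
    have := mul_nonneg hγ.le hcon
    linarith
  -- Since `k - r² < 0`, excess mass of `φ` would give `B < γ (k - r²) ≤ A`, against `A ≤ B`.
  have hI : ∫ y, φ y ∂P = γ := by
    refine le_antisymm ?_ h6
    by_contra hcon
    push Not at hcon
    have := mul_lt_mul_of_neg_right hcon hk
    linarith
  rw [hI] at e2
  have hAB : A = B := by linarith
  -- Equality in the Neyman–Pearson comparison: `φ` and `ψ` agree a.e. off the level set.
  have h8 : (fun y => (trimDist P φ y - (trimRadius P γ φ) ^ 2) * (φ y - ψ y)) =ᵐ[P] 0 := by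
    have hint := (integrable_trimDist_mul (φ := φ) hφ (trimRadius P γ φ ^ 2)).sub
      (integrable_trimDist_mul (φ := φ) hψ.mem (trimRadius P γ φ ^ 2))
    refine (integral_eq_zero_iff_of_nonneg_ae (hψ.mul_le_mul hφ) (hint.congr
      (Eventually.of_forall fun y => ?_))).1 ?_
    · simp only [Pi.sub_apply]; ring
    · simp only [mul_sub]
      rw [integral_sub (integrable_trimDist_mul hφ _) (integrable_trimDist_mul hψ.mem _)]
      linarith
  refine ⟨hφ, hI, ?_, ?_⟩
  · filter_upwards [h8, hψ.eq_one] with y h9 h10 hy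
    rcases mul_eq_zero.1 h9 with h | h
    · linarith
    · linarith [h10 hy]
  · filter_upwards [h8, hψ.eq_zero] with y h9 h10 hy
    rcases mul_eq_zero.1 h9 with h | h
    · linarith
    · linarith [h10 hy]

end Concentration

/-! ### Perturbed measures -/

section Perturb

variable {P : Measure (Space k)} [IsProbabilityMeasure P] {x : Space k} {ε : ℝ}

theorem perturb_zero (P : Measure (Space k)) (x : Space k) : perturb P x 0 = P := by
  simp [perturb]

theorem isProbabilityMeasure_perturb (P : Measure (Space k)) [IsProbabilityMeasure P]
    (x : Space k) (h : ε ∈ Set.Icc (0 : ℝ) 1) : IsProbabilityMeasure (perturb P x ε) := by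
  constructor
  simp only [perturb, Measure.coe_add, Measure.coe_smul, Pi.add_apply, Pi.smul_apply, measure_univ,
    smul_eq_mul, mul_one]
  rw [← ENNReal.ofReal_add (by linarith [h.2]) h.1]
  simp

theorem integral_perturb {F : Type*} [NormedAddCommGroup F] [NormedSpace ℝ F] [CompleteSpace F]
    (h : ε ∈ Set.Icc (0 : ℝ) 1) {f : Space k → F} (hf : Integrable f P) :
    ∫ y, f y ∂(perturb P x ε) = (1 - ε) • (∫ y, f y ∂P) + ε • f x := by
  have h1 : Integrable f (ENNReal.ofReal (1 - ε) • P) := hf.smul_measure ENNReal.ofReal_ne_top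
  have h2 : Integrable f (ENNReal.ofReal ε • Measure.dirac x) :=
    (integrable_dirac (by simp)).smul_measure ENNReal.ofReal_ne_top
  rw [perturb, integral_add_measure h1 h2, integral_smul_measure, integral_smul_measure,
    integral_dirac, ENNReal.toReal_ofReal (by linarith [h.2]), ENNReal.toReal_ofReal h.1]

theorem perturb_real_le (h : ε ∈ Set.Icc (0 : ℝ) 1) (A : Set (Space k)) :
    (perturb P x ε).real A ≤ P.real A + ε := by
  have h1 : (perturb P x ε) A ≤ P A + ENNReal.ofReal ε := by
    simp only [perturb, Measure.coe_add, Measure.coe_smul, Pi.add_apply, Pi.smul_apply, smul_eq_mul]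
    refine add_le_add ?_ ?_
    · exact mul_le_of_le_one_left' (ENNReal.ofReal_le_one.2 (by linarith [h.1]))
    · exact mul_le_of_le_one_right' prob_le_one
  have h2 := ENNReal.toReal_mono (by finiteness) h1
  rwa [ENNReal.toReal_add (by finiteness) (by finiteness), ENNReal.toReal_ofReal h.1] at h2

theorem le_perturb_real (h : ε ∈ Set.Icc (0 : ℝ) 1) (A : Set (Space k)) :
    (1 - ε) * P.real A ≤ (perturb P x ε).real A := by
  have := isProbabilityMeasure_perturb P x h
  have h1 : ENNReal.ofReal (1 - ε) * P A ≤ (perturb P x ε) A := by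
    simp only [perturb, Measure.coe_add, Measure.coe_smul, Pi.add_apply, Pi.smul_apply, smul_eq_mul]
    exact le_self_add
  have h2 := ENNReal.toReal_mono (measure_ne_top _ _) h1
  rwa [ENNReal.toReal_mul, ENNReal.toReal_ofReal (by linarith [h.2])] at h2

theorem ae_of_ae_perturb (h : ε < 1) {p : Space k → Prop} (hp : ∀ᵐ y ∂(perturb P x ε), p y) :
    ∀ᵐ y ∂P, p y := by
  have h1 : P ≪ perturb P x ε := by
    refine Measure.AbsolutelyContinuous.add_right ?_ _
    exact (Measure.AbsolutelyContinuous.smul_right Measure.AbsolutelyContinuous.rfl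
      (by simpa using h))
  exact h1.ae_le hp

theorem ae_perturb {p : Space k → Prop} (hp : ∀ᵐ y ∂P, p y) (hx : p x) :
    ∀ᵐ y ∂(perturb P x ε), p y := by
  rw [perturb, ae_add_measure_iff]
  refine ⟨Measure.ae_smul_measure hp _, Measure.ae_smul_measure ?_ _⟩
  rw [ae_dirac_eq]
  exact hx

end Perturb

/-! ### Uniform bounds -/

theorem exists_ball_mass_gt (P : Measure (Space k)) [IsProbabilityMeasure P] {c : ℝ} (hc : c < 1) :
    ∃ R, 0 < R ∧ c ≤ P.real {y | ‖y‖ ≤ R} := by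
  obtain ⟨s, hs, h⟩ := exists_mass_ge (P := P) (q := fun y => ‖y‖ ^ 2) (γ := c) hc
  refine ⟨s, hs, h.trans (measureReal_mono fun y hy => ?_)⟩
  exact (pow_le_pow_iff_left₀ (norm_nonneg y) hs.le two_ne_zero).1 hy

/-- Thin slabs have mass uniformly less than `γ` if all hyperplanes have mass less than `γ`. -/
theorem exists_slab_mass_le (P : Measure (Space k)) [IsProbabilityMeasure P] {γ : ℝ} (hγ : 0 < γ)
    (hyper : ∀ (a : Space k) (b : ℝ), a ≠ 0 → P.real {y | inner ℝ a y = b} < γ) :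
    ∃ δ τ : ℝ, 0 < δ ∧ 0 < τ ∧ ∀ a : Space k, ‖a‖ = 1 → ∀ b : ℝ,
      P.real {y | |inner ℝ a y - b| ≤ δ} ≤ γ - τ := by
  by_contra hcon
  push Not at hcon
  obtain ⟨R, hR, hball⟩ := exists_ball_mass_gt P (c := 1 - γ / 2) (by linarith)
  -- From index `N` on, the slabs have mass more than `γ / 2` and so meet the ball of mass at least
  -- `1 - γ / 2`. This confines the offsets `b` to a compact interval.
  obtain ⟨N, hN⟩ := exists_nat_gt (2 / γ)
  have hu0 : ∀ n : ℕ, 0 < 1 / ((n : ℝ) + 1) := fun n => by positivity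
  have hslab : ∀ n : ℕ, ∃ p : Space k × ℝ, p ∈ Metric.sphere (0 : Space k) 1 ×ˢ
      Set.Icc (-(R + 1)) (R + 1) ∧ γ - 1 / ((n + N : ℕ) + 1 : ℝ) <
        P.real {y | |inner ℝ p.1 y - p.2| ≤ 1 / ((n + N : ℕ) + 1 : ℝ)} := by
    intro n
    obtain ⟨a, ha, b, hab⟩ := hcon _ _ (hu0 (n + N)) (hu0 (n + N))
    refine ⟨(a, b), ⟨by simpa using ha, ?_⟩, hab⟩
    have hsmall : 1 / ((n + N : ℕ) + 1 : ℝ) ≤ γ / 2 := by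
      rw [div_lt_iff₀ hγ] at hN
      rw [div_le_iff₀ (by positivity)]
      push_cast
      nlinarith [Nat.cast_nonneg (α := ℝ) n]
    have hone : 1 / ((n + N : ℕ) + 1 : ℝ) ≤ 1 := by
      rw [div_le_one (by positivity)]
      linarith [Nat.cast_nonneg (α := ℝ) (n + N)]
    have hmeet : ({y | |inner ℝ a y - b| ≤ 1 / ((n + N : ℕ) + 1 : ℝ)} ∩
        {y : Space k | ‖y‖ ≤ R}).Nonempty := by
      by_contra hempty
      rw [Set.not_nonempty_iff_eq_empty, ← Set.disjoint_iff_inter_eq_empty] at hempty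
      have hm : MeasurableSet {y : Space k | ‖y‖ ≤ R} :=
        measurableSet_le continuous_norm.measurable measurable_const
      have := measureReal_union (μ := P) hempty hm
      have h2 : P.real ({y | |inner ℝ a y - b| ≤ 1 / ((n + N : ℕ) + 1 : ℝ)} ∪
        {y : Space k | ‖y‖ ≤ R}) ≤ 1 := measureReal_le_one
      linarith
    obtain ⟨y, hy1, hy2⟩ := hmeet
    have h3 : |inner ℝ a y| ≤ R := (abs_real_inner_le_norm a y).trans (by rw [ha, one_mul]; exact hy2)
    have h4 : |inner ℝ a y - b| ≤ 1 := (show |inner ℝ a y - b| ≤ _ from hy1).trans hone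
    rw [abs_le] at h3 h4
    constructor <;> linarith
  choose p hp hpm using hslab
  have hcomp : IsCompact (Metric.sphere (0 : Space k) 1 ×ˢ Set.Icc (-(R + 1)) (R + 1)) :=
    (isCompact_sphere _ _).prod isCompact_Icc
  obtain ⟨⟨a, b⟩, hab, σ, hσ, hlim⟩ := hcomp.tendsto_subseq hp
  have ha : Tendsto (fun n => (p (σ n)).1) atTop (𝓝 a) := (continuous_fst.tendsto _).comp hlim
  have hb : Tendsto (fun n => (p (σ n)).2) atTop (𝓝 b) := (continuous_snd.tendsto _).comp hlim
  set u : ℕ → ℝ := fun n => 1 / ((σ n + N : ℕ) + 1 : ℝ) with hu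
  have hut : Tendsto u atTop (𝓝 0) := by
    have h1 : Tendsto (fun n => σ n + N) atTop atTop :=
      tendsto_atTop_mono (fun n => Nat.le_add_right _ _) hσ.tendsto_atTop
    exact tendsto_one_div_add_atTop_nhds_zero_nat.comp h1
  set A : ℕ → Set (Space k) := fun n => {y | |inner ℝ (p (σ n)).1 y - (p (σ n)).2| ≤ u n} with hA
  have hAm : ∀ n, MeasurableSet (A n) := fun n =>
    measurableSet_le (Continuous.abs (by fun_prop)).measurable measurable_const
  -- The limsup of the slabs still has mass at least `γ` and lies in the limiting hyperplane.
  set B : ℕ → Set (Space k) := fun n => ⋃ m, ⋃ (_ : n ≤ m), A m with hB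
  have hBanti : Antitone B := by
    intro i j hij
    refine Set.iUnion_mono fun m => Set.iUnion_mono' fun h => ⟨hij.trans h, le_rfl⟩
  have hBm : ∀ n, MeasurableSet (B n) := fun n =>
    MeasurableSet.iUnion fun m => MeasurableSet.iUnion fun _ => hAm m
  have h1 := tendsto_measure_iInter_atTop (μ := P) (fun n => (hBm n).nullMeasurableSet) hBanti
    ⟨0, measure_ne_top P _⟩
  have h3 := (ENNReal.tendsto_toReal (measure_ne_top P _)).comp h1
  have hBγ : ∀ n, γ ≤ P.real (B n) := by
    intro n
    have h4 : ∀ᶠ m in atTop, γ - u m ≤ P.real (B n) := by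
      filter_upwards [eventually_ge_atTop n] with m hm
      refine (hpm (σ m)).le.trans (measureReal_mono ?_ (measure_ne_top P _))
      exact Set.subset_iUnion₂ (s := fun m (_ : n ≤ m) => A m) m hm
    have h5 : Tendsto (fun m => γ - u m) atTop (𝓝 (γ - 0)) := tendsto_const_nhds.sub hut
    rw [sub_zero] at h5
    exact le_of_tendsto h5 h4
  have h6 : γ ≤ P.real (⋂ n, B n) := ge_of_tendsto' h3 hBγ
  have ha1 : ‖a‖ = 1 := by simpa using hab.1
  have ha0 : a ≠ 0 := fun h => by simp [h] at ha1
  refine absurd (hyper a b ha0) (not_lt.2 (h6.trans (measureReal_mono fun y hy => ?_)))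
  by_contra hne
  have hpos : 0 < |inner ℝ a y - b| := abs_pos.2 (sub_ne_zero.2 hne)
  have h7 : Tendsto (fun n => |inner ℝ (p (σ n)).1 y - (p (σ n)).2| - u n) atTop
      (𝓝 (|inner ℝ a y - b| - 0)) :=
    ((ha.inner tendsto_const_nhds).sub hb).abs.sub hut
  rw [sub_zero] at h7
  obtain ⟨n, hn⟩ := eventually_atTop.1 (h7.eventually (lt_mem_nhds hpos))
  obtain ⟨m, hm, hy'⟩ := Set.mem_iUnion₂.1 (Set.mem_iInter.1 hy n)
  have h8 : |inner ℝ (p (σ m)).1 y - (p (σ m)).2| ≤ u m := hy'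
  linarith [hn m hm]

/-- Slabs of half-width `δ` have mass at most `γ - τ`, and most of the mass lies in the ball of
radius `R`. -/
structure Tame (P : Measure (Space k)) (γ δ τ R : ℝ) : Prop where
  slab : ∀ a : Space k, ‖a‖ = 1 → ∀ b : ℝ, P.real {y | |inner ℝ a y - b| ≤ δ} ≤ γ - τ
  ball : γ ≤ P.real {y | ‖y‖ ≤ R}
  ball' : 1 - γ / 2 ≤ P.real {y | ‖y‖ ≤ R}

theorem exists_tame_perturb (P : Measure (Space k)) [IsProbabilityMeasure P] (x : Space k) {γ : ℝ}
    (hγ : 0 < γ) (hγ1 : γ < 1)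
    (hyper : ∀ (a : Space k) (b : ℝ), a ≠ 0 → P.real {y | inner ℝ a y = b} < γ) :
    ∃ e δ τ R : ℝ, 0 < e ∧ e < 1 ∧ e < γ ∧ 0 < δ ∧ 0 < τ ∧ 0 < R ∧
      ∀ ε ∈ Set.Icc 0 e, Tame (perturb P x ε) γ δ τ R := by
  obtain ⟨δ, τ, hδ, hτ, hs⟩ := exists_slab_mass_le P hγ hyper
  obtain ⟨c, hc1, hc2⟩ := exists_between (max_lt hγ1 (show 1 - γ / 2 < 1 by linarith))
  obtain ⟨R, hR, hb⟩ := exists_ball_mass_gt P hc2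
  obtain ⟨hcγ, hcγ'⟩ := max_lt_iff.1 hc1
  -- Contamination by `ε` changes the masses of slabs and of the ball by at most `ε`: half of `τ` is
  -- given up for the slabs, and the slack up to `c` for the two ball conditions.
  set e := min (τ / 2) (min (γ / 2) (min (c - γ) (c - (1 - γ / 2)))) with he
  have e1 : e ≤ τ / 2 := min_le_left _ _
  have e2 : e ≤ γ / 2 := (min_le_right _ _).trans (min_le_left _ _)
  have e3 : e ≤ c - γ := (min_le_right _ _).trans ((min_le_right _ _).trans (min_le_left _ _))
  have e4 : e ≤ c - (1 - γ / 2) :=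
    (min_le_right _ _).trans ((min_le_right _ _).trans (min_le_right _ _))
  have he0 : 0 < e := lt_min (by linarith) (lt_min (by linarith) (lt_min (by linarith)
    (by linarith)))
  refine ⟨e, δ, τ / 2, R, he0, by linarith, by linarith, hδ, by linarith, hR, fun ε hε => ?_⟩
  have hε1 : ε ∈ Set.Icc (0 : ℝ) 1 := ⟨hε.1, by linarith [hε.2]⟩
  have hball := le_perturb_real (P := P) (x := x) hε1 {y | ‖y‖ ≤ R}
  have hle : P.real {y | ‖y‖ ≤ R} ≤ 1 := measureReal_le_one
  have hball2 : P.real {y | ‖y‖ ≤ R} - ε ≤ (perturb P x ε).real {y | ‖y‖ ≤ R} := by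
    nlinarith [hε.1]
  refine ⟨fun a ha b => ?_, by linarith [hε.2], by linarith [hε.2]⟩
  exact (perturb_real_le hε1 _).trans (by linarith [hs a ha b, hε.2])

section Bounds

variable {P : Measure (Space k)} [IsProbabilityMeasure P] {γ δ τ R : ℝ} {φ : Space k → ℝ}

theorem Tame.le_quad (h : Tame P γ δ τ R) (hγ : 0 < γ) (hδ : 0 < δ) (hφ : φ ∈ trimClass P γ)
    (a : Space k) : δ ^ 2 * τ * ‖a‖ ^ 2 ≤ quad (trimCov P φ) a :=
  le_quad_trimCov hγ hφ hδ.le h.slab a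

theorem Tame.posDef (h : Tame P γ δ τ R) (hγ : 0 < γ) (hδ : 0 < δ) (hτ : 0 < τ)
    (hφ : φ ∈ trimClass P γ) : (trimCov P φ).PosDef :=
  posDef_of_le_quad (trimCov_isSymm P φ) (by positivity) (h.le_quad hγ hδ hφ)

/-- At least `γ / 2` of the mass of `φ` lies in the ball of radius `R`, so a mean far outside that
ball forces a large total variance. -/
theorem Tame.norm_trimMean_le (h : Tame P γ δ τ R) (hγ : 0 < γ)
    (hφ : φ ∈ trimClass P γ) :
    ‖trimMean P φ‖ ≤ R + 1 + 2 * (trimCov P φ).trace / γ := by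
  set T := trimMean P φ
  set t := (trimCov P φ).trace
  have ht : 0 ≤ t := (trimCov_posSemidef hγ hφ).trace_nonneg
  rcases le_or_gt ‖T‖ R with hT | hT
  · have : 0 ≤ 2 * t / γ := by positivity
    linarith
  have h1 := integral_norm_sq_mul hγ hφ
  set A : Set (Space k) := {y | ‖y‖ ≤ R} with hA
  have hAm : MeasurableSet A := measurableSet_le continuous_norm.measurable measurable_const
  have hA1 : Integrable (Aᶜ.indicator (1 : Space k → ℝ)) P :=
    (integrable_const 1).indicator hAm.compl
  have hI : Integrable (fun y => ‖y - T‖ ^ 2 * φ y) P := by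
    simpa only [quad_one] using integrable_quad_mul hφ 1 T
  have h2 : ∫ y, (‖T‖ - R) ^ 2 * (φ y - Aᶜ.indicator 1 y) ∂P ≤ ∫ y, ‖y - T‖ ^ 2 * φ y ∂P := by
    refine integral_mono (((integrable_trim hφ).sub hA1).const_mul _) hI fun y => ?_
    have hy := hφ.2.1 y
    by_cases hyA : y ∈ A
    · simp only [Set.indicator_of_notMem (Set.notMem_compl_iff.2 hyA), sub_zero]
      refine mul_le_mul_of_nonneg_right (pow_le_pow_left₀ (by linarith) ?_ 2) hy.1
      have h3 : ‖T‖ - ‖y‖ ≤ ‖y - T‖ := by rw [norm_sub_rev]; exact norm_sub_norm_le T y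
      have h4 : ‖y‖ ≤ R := hyA
      linarith
    · simp only [Set.indicator_of_mem (Set.mem_compl hyA), Pi.one_apply]
      exact (mul_nonpos_of_nonneg_of_nonpos (sq_nonneg _) (by linarith [hy.2])).trans
        (mul_nonneg (sq_nonneg _) hy.1)
  rw [integral_const_mul, integral_sub (integrable_trim hφ) hA1,
    integral_indicator_one hAm.compl, h1, probReal_compl_eq_one_sub hAm] at h2
  have h3 := h.ball'
  have h4 := integral_trim_le_one hφ
  have h6 := hφ.2.2.1
  have h7 : (‖T‖ - R) ^ 2 * (γ / 2) ≤ t := by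
    have h8 : (‖T‖ - R) ^ 2 * (γ / 2) ≤ (‖T‖ - R) ^ 2 * ((∫ y, φ y ∂P) - (1 - P.real A)) :=
      mul_le_mul_of_nonneg_left (by linarith) (sq_nonneg _)
    have h9 : (∫ y, φ y ∂P) * t ≤ 1 * t := mul_le_mul_of_nonneg_right h4 ht
    linarith
  have h10 : (‖T‖ - R) ^ 2 ≤ 2 * t / γ := by
    rw [le_div_iff₀ hγ]; linarith
  nlinarith [sq_nonneg (‖T‖ - R - 1)]

/-- The ellipsoid of this radius contains the ball of radius `R`. The summand `1` makes the radius
positive and allows `t ≤ (1 + t)²` in place of a square root. -/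
theorem Tame.trimRadius_le (h : Tame P γ δ τ R) (hγ : 0 < γ) (hδ : 0 < δ) (hτ : 0 < τ)
    (hR : 0 < R) (hφ : φ ∈ trimClass P γ) :
    trimRadius P γ φ ≤ 1 + (R + ‖trimMean P φ‖) ^ 2 / (δ ^ 2 * τ) := by
  have h0 : 0 ≤ (R + ‖trimMean P φ‖) ^ 2 / (δ ^ 2 * τ) := by positivity
  refine MCD.trimRadius_le (by linarith) (h.ball.trans (measureReal_mono fun y hy => ?_))
  have h1 := mul_quad_inv_le (h.posDef hγ hδ hτ hφ) (h.le_quad hγ hδ hφ) (y - trimMean P φ)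
  have h2 : ‖y - trimMean P φ‖ ≤ R + ‖trimMean P φ‖ :=
    (norm_sub_le _ _).trans (add_le_add_left (show ‖y‖ ≤ R from hy) _)
  have h3 := pow_le_pow_left₀ (norm_nonneg _) h2 2
  have h4 : trimDist P φ y ≤ (R + ‖trimMean P φ‖) ^ 2 / (δ ^ 2 * τ) := by
    rw [le_div_iff₀ (by positivity), trimDist]
    linarith
  change trimDist P φ y ≤ _
  nlinarith

/-- Otherwise the ellipsoid of mass at least `γ` would fit into a slab of half-width `δ`. This keeps
radii away from `0`; `k ≥ 1` supplies a direction for the slab. -/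
theorem Tame.le_trace_mul_sq (hk : 1 ≤ k) (h : Tame P γ δ τ R) (hγ : 0 < γ) (hγ1 : γ < 1)
    (hδ : 0 < δ) (hτ : 0 < τ) (hφ : φ ∈ trimClass P γ) :
    δ ^ 2 ≤ (trimCov P φ).trace * trimRadius P γ φ ^ 2 := by
  by_contra hcon
  push Not at hcon
  have hC := h.posDef hγ hδ hτ hφ
  set e : Space k := EuclideanSpace.single (⟨0, hk⟩ : Fin k) 1
  have he : ‖e‖ = 1 := by simp [e]
  have h1 := h.slab e he (inner ℝ e (trimMean P φ))
  have h2 := le_mass_trimRadius (P := P) (φ := φ) hγ1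
  have h3 : {y | trimDist P φ y ≤ trimRadius P γ φ ^ 2} ⊆
      {y | |inner ℝ e y - inner ℝ e (trimMean P φ)| ≤ δ} := by
    intro y hy
    have hy' : trimDist P φ y ≤ trimRadius P γ φ ^ 2 := hy
    have h4 := norm_sq_le_trace_mul_quad_inv hC (y - trimMean P φ)
    have h5 := mul_le_mul_of_nonneg_left hy' hC.posSemidef.trace_nonneg
    have h6 : ‖y - trimMean P φ‖ ≤ δ := by
      refine (pow_le_pow_iff_left₀ (norm_nonneg _) hδ.le two_ne_zero).1 ?_
      rw [trimDist] at h5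
      linarith
    change |inner ℝ e y - inner ℝ e (trimMean P φ)| ≤ δ
    rw [← inner_sub_right]
    refine (abs_real_inner_le_norm _ _).trans ?_
    rwa [he, one_mul]
  have := measureReal_mono (μ := P) h3
  linarith

end Bounds

/-- Uniform bounds for the parameters of trimming functions whose covariance determinant is
bounded. -/
theorem exists_param_bounds (hk : 1 ≤ k) {γ δ τ R : ℝ} (hγ : 0 < γ) (hγ1 : γ < 1) (hδ : 0 < δ)
    (hτ : 0 < τ) (hR : 0 < R) (M : ℝ) :
    ∃ K r₀ : ℝ, 0 < K ∧ 0 < r₀ ∧ ∀ (P : Measure (Space k)) [IsProbabilityMeasure P],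
      Tame P γ δ τ R → ∀ φ ∈ trimClass P γ, (trimCov P φ).det ≤ M →
        ‖trimMean P φ‖ ≤ K ∧ (trimCov P φ).trace ≤ K ∧ r₀ ≤ trimRadius P γ φ ∧
          trimRadius P γ φ ≤ K := by
  set l := δ ^ 2 * τ with hl
  have hl0 : 0 < l := by positivity
  -- The bound on the trace, which then bounds the mean by `K₁` and the radius by `K₂`. Having `t ≥
  -- 1` gives `δ² ≤ t r² ≤ (t r)²`, hence the lower radius `δ / t`.
  set t := max 1 (k * (M / l ^ (k - 1))) with ht
  have ht1 : 1 ≤ t := le_max_left _ _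
  set K₁ := R + 1 + 2 * t / γ with hK₁
  have hK₁0 : 0 < K₁ := by positivity
  set K₂ := 1 + (R + K₁) ^ 2 / l with hK₂
  have hK₂0 : 0 < K₂ := by positivity
  refine ⟨max t (max K₁ K₂), δ / t, by positivity, by positivity, ?_⟩
  intro P _ hP φ hφ hM
  have h1 : (trimCov P φ).trace ≤ t :=
    (trace_le_of_det_le (trimCov_isSymm P φ) hl0 (hP.le_quad hγ hδ hφ) hM).trans (le_max_right _ _)
  have h2 : ‖trimMean P φ‖ ≤ K₁ := (hP.norm_trimMean_le hγ hφ).trans (by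
    rw [hK₁]; gcongr)
  have h3 : trimRadius P γ φ ≤ K₂ := (hP.trimRadius_le hγ hδ hτ hR hφ).trans (by
    rw [hK₂]; gcongr)
  have h4 := hP.le_trace_mul_sq hk hγ hγ1 hδ hτ hφ
  have h5 : 0 ≤ trimRadius P γ φ := trimRadius_nonneg
  refine ⟨h2.trans ((le_max_left _ _).trans (le_max_right _ _)), h1.trans (le_max_left _ _), ?_,
    h3.trans ((le_max_right _ _).trans (le_max_right _ _))⟩
  rw [div_le_iff₀ (by positivity)]
  refine (pow_le_pow_iff_left₀ hδ.le (by positivity) two_ne_zero).1 (h4.trans ?_)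
  have h6 : (trimCov P φ).trace * trimRadius P γ φ ^ 2 ≤ t * trimRadius P γ φ ^ 2 :=
    mul_le_mul_of_nonneg_right h1 (sq_nonneg _)
  have h7 : t * trimRadius P γ φ ^ 2 ≤ t * (t * trimRadius P γ φ ^ 2) :=
    le_mul_of_one_le_left (by positivity) ht1
  nlinarith

/-! ### Convergence of trimmed moments -/

section Convergence

variable {P : Measure (Space k)} [IsProbabilityMeasure P] {γ R : ℝ} {x : Space k}

theorem exists_bound_mul_of_support {f : Space k → ℝ} (hf : Continuous f) (R : ℝ) :
    ∃ K, ∀ (y : Space k) (c : ℝ), c ∈ Set.Icc (0 : ℝ) 1 → (c ≠ 0 → ‖y‖ ≤ R) → ‖f y * c‖ ≤ K := by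
  obtain ⟨K, hK⟩ := (isCompact_closedBall (0 : Space k) R).exists_bound_of_continuousOn
    hf.continuousOn
  refine ⟨max K 0, fun y c hc hs => ?_⟩
  by_cases h0 : c = 0
  · simp [h0]
  · rw [norm_mul, Real.norm_of_nonneg hc.1]
    have h1 := hK y (by simpa using hs h0)
    calc ‖f y‖ * c ≤ ‖f y‖ * 1 := mul_le_mul_of_nonneg_left hc.2 (norm_nonneg _)
      _ ≤ max K 0 := by rw [mul_one]; exact h1.trans (le_max_left _ _)

/-- Dominated convergence under `P`; the atom at `x` contributes a separate term, hence the separate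
convergence hypothesis there. -/
theorem tendsto_integral_perturb {ι : Type*} {l : Filter ι} [l.IsCountablyGenerated] [l.NeBot]
    {ε : ι → ℝ} {ε₀ : ℝ} (hε01 : ∀ᶠ n in l, ε n ∈ Set.Icc (0 : ℝ) 1) (hε : Tendsto ε l (𝓝 ε₀))
    {ψ : ι → Space k → ℝ} {ψ₀ : Space k → ℝ} (hm : ∀ᶠ n in l, Measurable (ψ n))
    (hm₀ : Measurable ψ₀)
    (h01 : ∀ᶠ n in l, ∀ y, ψ n y ∈ Set.Icc (0 : ℝ) 1)
    (hs : ∀ᶠ n in l, ∀ᵐ y ∂P, ψ n y ≠ 0 → ‖y‖ ≤ R)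
    (hlim : ∀ᵐ y ∂P, Tendsto (fun n => ψ n y) l (𝓝 (ψ₀ y)))
    (hx : Tendsto (fun n => ψ n x) l (𝓝 (ψ₀ x))) {f : Space k → ℝ} (hf : Continuous f) :
    Tendsto (fun n => ∫ y, f y * ψ n y ∂(perturb P x (ε n))) l
      (𝓝 (∫ y, f y * ψ₀ y ∂(perturb P x ε₀))) := by
  obtain ⟨K, hK⟩ := exists_bound_mul_of_support hf R
  have hmeas : ∀ᶠ n in l, AEStronglyMeasurable (fun y => f y * ψ n y) P := by
    filter_upwards [hm] with n hn
    exact (hf.measurable.mul hn).aestronglyMeasurable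
  have hbound : ∀ᶠ n in l, ∀ᵐ y ∂P, ‖f y * ψ n y‖ ≤ K := by
    filter_upwards [h01, hs] with n hn hsn
    filter_upwards [hsn] with y hy
    exact hK y _ (hn y) hy
  have hlim' : ∀ᵐ y ∂P, Tendsto (fun n => f y * ψ n y) l (𝓝 (f y * ψ₀ y)) := by
    filter_upwards [hlim] with y hy
    exact hy.const_mul _
  have h1 := tendsto_integral_filter_of_dominated_convergence (fun _ => K) hmeas hbound
    (integrable_const K) hlim'
  have hint : Integrable (fun y => f y * ψ₀ y) P := by
    refine Integrable.of_bound (hf.measurable.mul hm₀).aestronglyMeasurable K ?_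
    -- The bound holds off a null set depending on `n`; a sequence in the filter leaves only
    -- countably many null sets to discard.
    obtain ⟨ns, hns⟩ := l.exists_seq_tendsto
    have : ∀ᵐ y ∂P, ∀ j, (∀ᵐ y ∂P, ‖f y * ψ (ns j) y‖ ≤ K) → ‖f y * ψ (ns j) y‖ ≤ K := by
      rw [ae_all_iff]
      intro j
      by_cases h : ∀ᵐ y ∂P, ‖f y * ψ (ns j) y‖ ≤ K
      · filter_upwards [h] with y hy _ using hy
      · exact Eventually.of_forall fun y h' => absurd h' h
    filter_upwards [hlim', this] with y hy hj
    refine le_of_tendsto (hy.comp hns).norm ?_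
    filter_upwards [hns.eventually hbound] with j hbj
    exact hj j hbj
  have h0 : ε₀ ∈ Set.Icc (0 : ℝ) 1 := isClosed_Icc.mem_of_tendsto hε hε01
  rw [integral_perturb h0 hint]
  have h2 : Tendsto (fun n => (1 - ε n) • (∫ y, f y * ψ n y ∂P) + ε n • (f x * ψ n x)) l
      (𝓝 ((1 - ε₀) • (∫ y, f y * ψ₀ y ∂P) + ε₀ • (f x * ψ₀ x))) :=
    ((tendsto_const_nhds.sub hε).smul h1).add (hε.smul (hx.const_mul _))
  refine h2.congr' ?_
  filter_upwards [hε01, hmeas, hbound] with n hn hn2 hn3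
  exact (integral_perturb hn (Integrable.of_bound hn2 K hn3)).symm

theorem tendsto_trimMean_trimCov {ι : Type*} {l : Filter ι} [l.IsCountablyGenerated] [l.NeBot]
    (hγ : 0 < γ)
    {ε : ι → ℝ} {ε₀ : ℝ} (hε01 : ∀ᶠ n in l, ε n ∈ Set.Icc (0 : ℝ) 1) (hε : Tendsto ε l (𝓝 ε₀))
    {ψ : ι → Space k → ℝ} {ψ₀ : Space k → ℝ}
    (hψ : ∀ᶠ n in l, ψ n ∈ trimClass (perturb P x (ε n)) γ)
    (hψ₀ : ψ₀ ∈ trimClass (perturb P x ε₀) γ)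
    (hs : ∀ᶠ n in l, ∀ᵐ y ∂P, ψ n y ≠ 0 → ‖y‖ ≤ R)
    (hlim : ∀ᵐ y ∂P, Tendsto (fun n => ψ n y) l (𝓝 (ψ₀ y)))
    (hx : Tendsto (fun n => ψ n x) l (𝓝 (ψ₀ x))) :
    Tendsto (fun n => trimMean (perturb P x (ε n)) (ψ n)) l
        (𝓝 (trimMean (perturb P x ε₀) ψ₀)) ∧
      Tendsto (fun n => trimCov (perturb P x (ε n)) (ψ n)) l
        (𝓝 (trimCov (perturb P x ε₀) ψ₀)) := by
  have h0 : ε₀ ∈ Set.Icc (0 : ℝ) 1 := isClosed_Icc.mem_of_tendsto hε hε01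
  have hP₀ := isProbabilityMeasure_perturb P x h0
  have key : ∀ f : Space k → ℝ, Continuous f →
      Tendsto (fun n => ∫ y, f y * ψ n y ∂(perturb P x (ε n))) l
      (𝓝 (∫ y, f y * ψ₀ y ∂(perturb P x ε₀))) := fun f hf =>
    tendsto_integral_perturb hε01 hε (hψ.mono fun n h => h.1) hψ₀.1 (hψ.mono fun n h => h.2.1) hs hlim hx
      hf
  have hI := key (fun _ => 1) continuous_const
  simp only [one_mul] at hI
  have hI' := hI.inv₀ (integral_trim_pos hγ hψ₀).ne'
  have hTi : ∀ i, Tendsto (fun n => trimMean (perturb P x (ε n)) (ψ n) i) l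
      (𝓝 (trimMean (perturb P x ε₀) ψ₀ i)) := by
    intro i
    rw [trimMean_apply hψ₀]
    refine (hI'.mul (key (fun y => y i) (by fun_prop))).congr' ?_
    filter_upwards [hε01, hψ] with n hn hψn
    have := isProbabilityMeasure_perturb P x hn
    rw [trimMean_apply hψn]
  constructor
  · have h1 : Tendsto (fun n => (trimMean (perturb P x (ε n)) (ψ n)).ofLp) l
        (𝓝 (trimMean (perturb P x ε₀) ψ₀).ofLp) := tendsto_pi_nhds.2 hTi
    exact ((PiLp.continuous_toLp 2 _).tendsto _).comp h1
  · refine tendsto_pi_nhds.2 fun i => tendsto_pi_nhds.2 fun j => ?_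
    rw [trimCov_apply hγ hψ₀]
    refine ((hI'.mul (key (fun y => y i * y j) (by fun_prop))).sub
      ((hTi i).mul (hTi j))).congr' ?_
    filter_upwards [hε01, hψ] with n hn hψn
    have := isProbabilityMeasure_perturb P x hn
    rw [trimCov_apply hγ hψn]

end Convergence

/-! ### Compactness -/

/-- The point `x` lies on the unit sphere about `x - e`, which is null. -/
theorem measure_singleton_eq_zero {P : Measure (Space k)} (hk : 1 ≤ k)
    (hnull : ∀ (m : Space k) (S : Matrix (Fin k) (Fin k) ℝ) (s : ℝ), S.PosDef → 0 < s →
      P {y | quad S⁻¹ (y - m) = s ^ 2} = 0) (x : Space k) : P {x} = 0 := by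
  set e : Space k := EuclideanSpace.single (⟨0, hk⟩ : Fin k) 1
  have he : ‖e‖ = 1 := by simp [e]
  refine measure_mono_null ?_ (hnull (x - e) 1 1 Matrix.PosDef.one one_pos)
  rintro y rfl
  simp [quad_one, he]

theorem exists_subseq_matrix {K : ℝ} {T : ℕ → Space k} {C : ℕ → Matrix (Fin k) (Fin k) ℝ}
    {r c : ℕ → ℝ} (hT : ∀ n, ‖T n‖ ≤ K) (hC : ∀ n i j, |C n i j| ≤ K)
    (hr : ∀ n, r n ∈ Set.Icc 0 K) (hc : ∀ n, c n ∈ Set.Icc (0 : ℝ) 1) :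
    ∃ (σ : ℕ → ℕ) (m : Space k) (S : Matrix (Fin k) (Fin k) ℝ) (r₀ c₀ : ℝ), StrictMono σ ∧
      Tendsto (fun n => T (σ n)) atTop (𝓝 m) ∧ Tendsto (fun n => C (σ n)) atTop (𝓝 S) ∧
      Tendsto (fun n => r (σ n)) atTop (𝓝 r₀) ∧ Tendsto (fun n => c (σ n)) atTop (𝓝 c₀) ∧
      c₀ ∈ Set.Icc (0 : ℝ) 1 := by
  have hcomp : IsCompact (Metric.closedBall (0 : Space k) K ×ˢ
      (Set.univ.pi fun _ : Fin k => Set.univ.pi fun _ : Fin k => Set.Icc (-K) K) ×ˢ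
      Set.Icc 0 K ×ˢ Set.Icc (0 : ℝ) 1) :=
    (isCompact_closedBall _ _).prod ((isCompact_univ_pi fun _ => isCompact_univ_pi fun _ =>
      isCompact_Icc).prod (isCompact_Icc.prod isCompact_Icc))
  obtain ⟨⟨m, S, r₀, c₀⟩, hmem, σ, hσ, hlim⟩ := hcomp.tendsto_subseq
    (x := fun n => (T n, (fun i j => C n i j), r n, c n)) (fun n =>
      ⟨by simpa using hT n, fun i _ j _ => abs_le.1 (hC n i j), hr n, hc n⟩)
  refine ⟨σ, m, Matrix.of S, r₀, c₀, hσ, (continuous_fst.tendsto _).comp hlim, ?_, ?_, ?_,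
    hmem.2.2.2⟩
  · exact ((continuous_fst.comp continuous_snd).tendsto _).comp hlim
  · exact ((continuous_fst.comp (continuous_snd.comp continuous_snd)).tendsto _).comp hlim
  · exact ((continuous_snd.comp (continuous_snd.comp continuous_snd)).tendsto _).comp hlim

theorem isSymm_of_tendsto {ι : Type*} {l : Filter ι} [l.NeBot] {C : ι → Matrix (Fin k) (Fin k) ℝ}
    {S : Matrix (Fin k) (Fin k) ℝ} (h : Tendsto C l (𝓝 S)) (hC : ∀ n, (C n).IsSymm) :
    S.IsSymm := by
  have h1 : Tendsto (fun n => (C n)ᵀ) l (𝓝 Sᵀ) :=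
    (Continuous.matrix_transpose continuous_id).continuousAt.tendsto.comp h
  exact tendsto_nhds_unique (h1.congr fun n => hC n) h

theorem le_quad_of_tendsto {ι : Type*} {l : Filter ι} [l.NeBot]
    {C : ι → Matrix (Fin k) (Fin k) ℝ} {S : Matrix (Fin k) (Fin k) ℝ} (h : Tendsto C l (𝓝 S))
    {b : ℝ} {a : Space k} (hC : ∀ n, b ≤ quad (C n) a) : b ≤ quad S a := by
  have h1 : Tendsto (fun n => (C n, a)) l (𝓝 (S, a)) := h.prodMk_nhds tendsto_const_nhds
  exact ge_of_tendsto' ((continuous_quad_prod.tendsto _).comp h1) hC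

theorem tendsto_step {q : ℕ → ℝ} {q₀ : ℝ} {r : ℕ → ℝ} {r₀ : ℝ} {ψ : ℕ → ℝ}
    (hq : Tendsto q atTop (𝓝 q₀)) (hr : Tendsto r atTop (𝓝 r₀)) (hne : q₀ ≠ r₀ ^ 2)
    (h1 : ∀ n, q n < r n ^ 2 → ψ n = 1) (h0 : ∀ n, r n ^ 2 < q n → ψ n = 0) :
    Tendsto ψ atTop (𝓝 (if q₀ ≤ r₀ ^ 2 then 1 else 0)) := by
  rcases lt_or_gt_of_ne hne with h | h
  · rw [if_pos h.le]
    refine tendsto_const_nhds.congr' ?_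
    filter_upwards [hq.eventually_lt (hr.pow 2) h] with n hn using (h1 n hn).symm
  · rw [if_neg (not_le.2 h)]
    refine tendsto_const_nhds.congr' ?_
    filter_upwards [(hr.pow 2).eventually_lt hq h] with n hn using (h0 n hn).symm

/-- Trimming functions for perturbed measures that are concentrated on ellipsoids whose
covariance determinants are bounded have convergent subsequences. -/
theorem exists_subseq_isStep (hk : 1 ≤ k) {P : Measure (Space k)} [IsProbabilityMeasure P]
    (x : Space k) {γ δ τ R e : ℝ} (hγ : 0 < γ) (hγ1 : γ < 1) (hδ : 0 < δ) (hτ : 0 < τ) (hR : 0 < R)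
    (he1 : e < 1) (htame : ∀ ε ∈ Set.Icc 0 e, Tame (perturb P x ε) γ δ τ R)
    (hnull : ∀ (m : Space k) (S : Matrix (Fin k) (Fin k) ℝ) (s : ℝ), S.PosDef → 0 < s →
      P {y | quad S⁻¹ (y - m) = s ^ 2} = 0)
    {M : ℝ} {ε : ℕ → ℝ} {ε₀ : ℝ} (hε : ∀ n, ε n ∈ Set.Icc 0 e) (hεl : Tendsto ε atTop (𝓝 ε₀))
    {φ ψ : ℕ → Space k → ℝ} (hφ : ∀ n, φ n ∈ trimClass (perturb P x (ε n)) γ)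
    (hM : ∀ n, (trimCov (perturb P x (ε n)) (φ n)).det ≤ M)
    (hψ : ∀ n, IsStep (perturb P x (ε n)) γ (φ n) (ψ n)) :
    ∃ (σ : ℕ → ℕ) (m : Space k) (S : Matrix (Fin k) (Fin k) ℝ) (r : ℝ) (ψ₀ : Space k → ℝ),
      StrictMono σ ∧ S.PosDef ∧ 0 < r ∧
      Tendsto (fun n => trimMean (perturb P x (ε (σ n))) (φ (σ n))) atTop (𝓝 m) ∧
      Tendsto (fun n => trimCov (perturb P x (ε (σ n))) (φ (σ n))) atTop (𝓝 S) ∧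
      Tendsto (fun n => trimRadius (perturb P x (ε (σ n))) γ (φ (σ n))) atTop (𝓝 r) ∧
      ψ₀ ∈ trimClass (perturb P x ε₀) γ ∧ ∫ y, ψ₀ y ∂(perturb P x ε₀) = γ ∧
      (∀ᵐ y ∂P, ψ₀ y = (ellipsoid m S r).indicator 1 y) ∧
      Tendsto (fun n => trimMean (perturb P x (ε (σ n))) (ψ (σ n))) atTop
        (𝓝 (trimMean (perturb P x ε₀) ψ₀)) ∧
      Tendsto (fun n => trimCov (perturb P x (ε (σ n))) (ψ (σ n))) atTop
        (𝓝 (trimCov (perturb P x ε₀) ψ₀)) := by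
  have hε01 : ∀ n, ε n ∈ Set.Icc (0 : ℝ) 1 := fun n => ⟨(hε n).1, (hε n).2.trans he1.le⟩
  have hprob : ∀ n, IsProbabilityMeasure (perturb P x (ε n)) := fun n =>
    isProbabilityMeasure_perturb P x (hε01 n)
  have hε₀ : ε₀ ∈ Set.Icc 0 e := isClosed_Icc.mem_of_tendsto hεl (Eventually.of_forall hε)
  have hprob₀ : IsProbabilityMeasure (perturb P x ε₀) :=
    isProbabilityMeasure_perturb P x ⟨hε₀.1, hε₀.2.trans he1.le⟩
  obtain ⟨K, r₁, hK, hr₁, hbd⟩ := exists_param_bounds hk hγ hγ1 hδ hτ hR M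
  have hb := fun n => hbd (perturb P x (ε n)) (htame _ (hε n)) (φ n) (hφ n) (hM n)
  have hPD : ∀ n, (trimCov (perturb P x (ε n)) (φ n)).PosDef := fun n =>
    (htame _ (hε n)).posDef hγ hδ hτ (hφ n)
  obtain ⟨σ, m, S, r, c, hσ, hT, hC, hr, hc, hc01⟩ := exists_subseq_matrix
    (T := fun n => trimMean (perturb P x (ε n)) (φ n))
    (C := fun n => trimCov (perturb P x (ε n)) (φ n))
    (r := fun n => trimRadius (perturb P x (ε n)) γ (φ n)) (c := fun n => ψ n x) (K := K)
    (fun n => (hb n).1) (fun n i j => (abs_apply_le_trace (hPD n).posSemidef i j).trans (hb n).2.1)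
    (fun n => ⟨trimRadius_nonneg, (hb n).2.2.2⟩) (fun n => (hψ n).mem.2.1 x)
  have hS : S.PosDef := posDef_of_le_quad
    (isSymm_of_tendsto hC fun n => trimCov_isSymm _ _) (by positivity : 0 < δ ^ 2 * τ)
    fun a => le_quad_of_tendsto hC fun n => (htame _ (hε _)).le_quad hγ hδ (hφ _) a
  have hr0 : 0 < r := hr₁.trans_le (ge_of_tendsto' hr fun n => (hb _).2.2.1)
  -- The limit measure may have an atom at `x`, and `x` may lie on the limiting boundary, where the
  -- values `ψ n x` are not determined; so their subsequential limit `c` is built in. Under `P` the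
  -- point `x` is null.
  set ψ₀ : Space k → ℝ := fun y => if y = x then c else (ellipsoid m S r).indicator 1 y with hψ₀
  have hEm : MeasurableSet (ellipsoid m S r) :=
    measurableSet_le ((continuous_quad S⁻¹).comp (by fun_prop :
      Continuous fun y : Space k => y - m)).measurable measurable_const
  have hψ₀m : Measurable ψ₀ := Measurable.ite (measurableSet_singleton x) measurable_const
    (measurable_one.indicator hEm)
  have hψ₀01 : ∀ y, ψ₀ y ∈ Set.Icc (0 : ℝ) 1 := by
    intro y
    simp only [hψ₀]
    split_ifs with h
    · exact hc01
    · by_cases hy : y ∈ ellipsoid m S r <;> simp [hy]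
  have hψ₀s : ∀ y, ψ₀ y ≠ 0 → ‖y‖ ≤ max ‖x‖ (‖m‖ + (1 + S.trace * r ^ 2)) := by
    intro y hy
    by_cases h : y = x
    · rw [h]; exact le_max_left _ _
    · simp only [hψ₀, h, if_false] at hy
      exact (norm_le_of_quad_inv_le hS (mem_ellipsoid.1 (Set.mem_of_indicator_ne_zero hy))).trans (le_max_right _ _)
  have hsupp : ∀ n, ∀ᵐ y ∂P, ψ n y ≠ 0 → ‖y‖ ≤ K + (1 + K * K ^ 2) := by
    intro n
    filter_upwards [ae_of_ae_perturb ((hε n).2.trans_lt he1) (hψ n).eq_zero] with y hy hne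
    have h1 : trimDist (perturb P x (ε n)) (φ n) y ≤
        trimRadius (perturb P x (ε n)) γ (φ n) ^ 2 := by
      by_contra hcon
      exact hne (hy (not_le.1 hcon))
    refine (norm_le_of_quad_inv_le (hPD n) h1).trans ?_
    obtain ⟨b1, b2, b3, b4⟩ := hb n
    have h0 : 0 ≤ trimRadius (perturb P x (ε n)) γ (φ n) := trimRadius_nonneg
    gcongr
  have hψ₀ae : ∀ᵐ y ∂P, ψ₀ y = (ellipsoid m S r).indicator 1 y := by
    have h1 := measure_singleton_eq_zero hk hnull x
    rw [measure_eq_zero_iff_ae_notMem] at h1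
    filter_upwards [h1] with y hy
    simp only [hψ₀, if_neg (show y ≠ x from hy)]
  have hlim : ∀ᵐ y ∂P, Tendsto (fun n => ψ (σ n) y) atTop (𝓝 (ψ₀ y)) := by
    have h1 := hnull m S r hS hr0
    rw [measure_eq_zero_iff_ae_notMem] at h1
    have h2 : ∀ᵐ y ∂P, ∀ n, trimDist (perturb P x (ε n)) (φ n) y <
        trimRadius (perturb P x (ε n)) γ (φ n) ^ 2 → ψ n y = 1 := ae_all_iff.2 fun n =>
      ae_of_ae_perturb ((hε n).2.trans_lt he1) (hψ n).eq_one
    have h3 : ∀ᵐ y ∂P, ∀ n, trimRadius (perturb P x (ε n)) γ (φ n) ^ 2 <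
        trimDist (perturb P x (ε n)) (φ n) y → ψ n y = 0 := ae_all_iff.2 fun n =>
      ae_of_ae_perturb ((hε n).2.trans_lt he1) (hψ n).eq_zero
    filter_upwards [h1, h2, h3, hψ₀ae] with y hy1 hy2 hy3 hy4
    rw [hy4]
    have h5 := tendsto_step (tendsto_quad_inv hS.det_pos.ne' hC hT y) hr hy1
      (fun n => hy2 (σ n)) (fun n => hy3 (σ n))
    by_cases hy : y ∈ ellipsoid m S r
    · rw [if_pos (mem_ellipsoid.1 hy)] at h5
      simpa [hy] using h5
    · rw [if_neg (fun h => hy (mem_ellipsoid.2 h))] at h5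
      simpa [hy] using h5
  have hx : Tendsto (fun n => ψ (σ n) x) atTop (𝓝 (ψ₀ x)) := by
    simpa [hψ₀] using hc
  have hεσ : Tendsto (fun n => ε (σ n)) atTop (𝓝 ε₀) := hεl.comp hσ.tendsto_atTop
  have hint := tendsto_integral_perturb (Eventually.of_forall fun n => hε01 (σ n)) hεσ
    (Eventually.of_forall fun n => (hψ (σ n)).mem.1) hψ₀m
    (Eventually.of_forall fun n => (hψ (σ n)).mem.2.1)
    (Eventually.of_forall fun n => hsupp (σ n)) hlim hx (f := fun _ => 1) continuous_const
  simp only [one_mul, (hψ _).integral_eq] at hint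
  have hint' : ∫ y, ψ₀ y ∂(perturb P x ε₀) = γ := tendsto_nhds_unique hint tendsto_const_nhds
  have hmem : ψ₀ ∈ trimClass (perturb P x ε₀) γ :=
    mem_trimClass_of_support hψ₀m hψ₀01 hψ₀s hint'.ge
  obtain ⟨g1, g2⟩ := tendsto_trimMean_trimCov hγ (Eventually.of_forall fun n => hε01 (σ n)) hεσ
    (Eventually.of_forall fun n => (hψ (σ n)).mem) hmem
    (Eventually.of_forall fun n => hsupp (σ n)) hlim hx
  exact ⟨σ, m, S, r, ψ₀, hσ, hS, hr0, hT, hC, hr, hmem, hint', hψ₀ae, g1, g2⟩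

theorem trimClass_nonempty {P : Measure (Space k)} [IsProbabilityMeasure P] {γ : ℝ} (hγ1 : γ < 1) :
    (trimClass P γ).Nonempty := by
  obtain ⟨R, hR, hb⟩ := exists_ball_mass_gt P hγ1
  have hm : MeasurableSet {y : Space k | ‖y‖ ≤ R} :=
    measurableSet_le continuous_norm.measurable measurable_const
  refine ⟨{y : Space k | ‖y‖ ≤ R}.indicator 1, mem_trimClass_of_support (R := R)
    (measurable_one.indicator hm) (fun y => ?_) (fun y hy => ?_) ?_⟩
  · by_cases hy : ‖y‖ ≤ R <;> simp [Set.indicator, hy]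
  · exact (Set.mem_of_indicator_ne_zero hy : y ∈ {y : Space k | ‖y‖ ≤ R})
  · rwa [integral_indicator_one hm]

/-- Existence of minimizing trimming functions. -/
theorem exists_isMinimizing_perturb (hk : 1 ≤ k) {P : Measure (Space k)} [IsProbabilityMeasure P]
    (x : Space k) {γ δ τ R e : ℝ} (hγ : 0 < γ) (hγ1 : γ < 1) (hδ : 0 < δ) (hτ : 0 < τ) (hR : 0 < R)
    (he1 : e < 1) (htame : ∀ ε ∈ Set.Icc 0 e, Tame (perturb P x ε) γ δ τ R)
    (hnull : ∀ (m : Space k) (S : Matrix (Fin k) (Fin k) ℝ) (s : ℝ), S.PosDef → 0 < s →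
      P {y | quad S⁻¹ (y - m) = s ^ 2} = 0)
    {ε : ℝ} (hε : ε ∈ Set.Icc 0 e) : ∃ φ, IsMinimizing (perturb P x ε) γ φ := by
  have hprob : IsProbabilityMeasure (perturb P x ε) :=
    isProbabilityMeasure_perturb P x ⟨hε.1, hε.2.trans he1.le⟩
  set Q := perturb P x ε with hQ
  set V := (fun φ => (trimCov Q φ).det) '' trimClass Q γ with hV
  have hbdd : BddBelow V := by
    refine ⟨0, ?_⟩
    rintro _ ⟨φ, hφ, rfl⟩
    exact (trimCov_posSemidef hγ hφ).det_nonneg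
  obtain ⟨u, hu, hul, huV⟩ := exists_seq_tendsto_sInf ((trimClass_nonempty hγ1).image _) hbdd
  choose φ hφ hφu using huV
  have hPD : ∀ n, (trimCov Q (φ n)).PosDef := fun n => (htame _ hε).posDef hγ hδ hτ (hφ n)
  -- Concentrating a minimizing sequence does not raise its determinants and gives it the
  -- compactness of ellipsoids.
  choose ψ hψ using fun n => exists_isStep hγ hγ1 (hPD n)
  obtain ⟨σ, m, S, r, ψ₀, hσ, -, -, -, -, -, hmem, -, -, -, hcov⟩ :=
    exists_subseq_isStep hk x hγ hγ1 hδ hτ hR he1 htame hnull (M := u 0) (ε := fun _ => ε)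
      (fun _ => hε) tendsto_const_nhds hφ (fun n => (hφu n).trans_le (hu (Nat.zero_le n))) hψ
  have hdet : Tendsto (fun n => (trimCov Q (ψ (σ n))).det) atTop (𝓝 (trimCov Q ψ₀).det) :=
    (Continuous.matrix_det continuous_id).continuousAt.tendsto.comp hcov
  have hle : (trimCov Q ψ₀).det ≤ sInf V := by
    refine le_of_tendsto_of_tendsto' hdet (hul.comp hσ.tendsto_atTop) fun n => ?_
    exact ((hψ _).det_le hγ (hφ _) (hPD _)).trans_eq (hφu _)
  exact ⟨ψ₀, hmem, fun χ hχ => hle.trans (csInf_le hbdd ⟨χ, hχ, rfl⟩)⟩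

/-! ### The topology of the symmetric matrices -/

theorem isInducing_mat : IsInducing (SymMat.mat : SymMat k → Matrix (Fin k) (Fin k) ℝ) :=
  ⟨rfl⟩

theorem continuous_mat : Continuous (SymMat.mat : SymMat k → Matrix (Fin k) (Fin k) ℝ) :=
  isInducing_mat.continuous

theorem mat_injective : Function.Injective (SymMat.mat : SymMat k → Matrix (Fin k) (Fin k) ℝ) :=
  Subtype.val_injective

theorem tendsto_symMat {ι : Type*} {l : Filter ι} {A : ι → SymMat k} {B : SymMat k} :
    Tendsto A l (𝓝 B) ↔ Tendsto (fun n => (A n).mat) l (𝓝 B.mat) :=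
  isInducing_mat.tendsto_nhds_iff

/-- The entries of a symmetric matrix, as continuous linear functionals. -/
noncomputable def SymMat.entry (i j : Fin k) : SymMat k →L[ℝ] ℝ where
  toFun A := A.mat i j
  map_add' _ _ := rfl
  map_smul' _ _ := rfl
  cont := continuous_mat.matrix_elem i j

theorem SymMat.ext_entry {A B : SymMat k} (h : ∀ i j, SymMat.entry i j A = SymMat.entry i j B) :
    A = B :=
  mat_injective (Matrix.ext h)

theorem continuous_outerSubOne : Continuous (outerSubOne : Space k → SymMat k) := by
  refine isInducing_mat.continuous_iff.2 ?_
  change Continuous fun z : Space k => Matrix.vecMulVec z.ofLp z.ofLp - 1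
  have h : Continuous fun z : Space k => z.ofLp := by fun_prop
  exact (h.matrix_vecMulVec h).sub continuous_const

/-- The entries of the roots are bounded through the trace, and each subsequential limit is a
positive semidefinite root of `S₀`, hence the root. -/
theorem tendsto_symSqrt {ι : Type*} {l : Filter ι} [l.IsCountablyGenerated]
    {S : ι → Matrix (Fin k) (Fin k) ℝ} {S₀ : Matrix (Fin k) (Fin k) ℝ}
    (hS : ∀ᶠ n in l, (S n).PosSemidef) (h : Tendsto S l (𝓝 S₀)) :
    Tendsto (fun n => symSqrt (S n)) l (𝓝 (symSqrt S₀)) := by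
  refine tendsto_of_subseq_tendsto fun ns hns => ?_
  have htr : Tendsto (fun n => (S n).trace) l (𝓝 S₀.trace) :=
    (Continuous.matrix_trace continuous_id).continuousAt.tendsto.comp h
  have hev : ∀ᶠ n in atTop, (S (ns n)).PosSemidef ∧ (S (ns n)).trace ≤ S₀.trace + 1 :=
    hns.eventually (hS.and (htr.eventually_le_const (by linarith)))
  obtain ⟨N, hN⟩ := eventually_atTop.1 hev
  have hb : ∀ n i j, |(symSqrt (S (ns (n + N)))).mat i j| ≤ S₀.trace + 2 := by
    intro n i j
    obtain ⟨h1, h2⟩ := hN (n + N) (Nat.le_add_left _ _)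
    have h3 := sq_apply_le_trace_mul_self (symSqrt_isSymm (S (ns (n + N)))) i j
    rw [symSqrt_mul_self h1] at h3
    rw [← sq_abs] at h3
    nlinarith [sq_nonneg (|(symSqrt (S (ns (n + N)))).mat i j| - 1), abs_nonneg
      ((symSqrt (S (ns (n + N)))).mat i j)]
  have h0 : 0 ≤ S₀.trace + 2 := by
    have h1 := (hN N le_rfl).1.trace_nonneg
    linarith [(hN N le_rfl).2]
  obtain ⟨σ, -, G, -, -, hσ, -, hG, -⟩ := exists_subseq_matrix (K := S₀.trace + 2)
    (T := fun _ => (0 : Space k)) (C := fun n => (symSqrt (S (ns (n + N)))).mat) (r := fun _ => 0)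
    (c := fun _ => 0) (fun n => by simpa using h0) hb (fun n => by simpa using h0)
    (fun n => by simp)
  refine ⟨fun n => σ n + N, tendsto_symMat.2 ?_⟩
  have hP : ∀ n, (S (ns (σ n + N))).PosSemidef := fun n => (hN _ (Nat.le_add_left _ _)).1
  have hGS : G * G = S₀ := by
    have h1 : Tendsto (fun n => (symSqrt (S (ns (σ n + N)))).mat *
      (symSqrt (S (ns (σ n + N)))).mat) atTop (𝓝 (G * G)) := hG.mul hG
    have h2 : Tendsto (fun n => S (ns (σ n + N))) atTop (𝓝 S₀) :=
      h.comp (hns.comp (tendsto_atTop_mono (fun n => Nat.le_add_right _ _) hσ.tendsto_atTop))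
    exact tendsto_nhds_unique (h1.congr fun n => symSqrt_mul_self (hP n)) h2
  have hG0 : G.PosSemidef := by
    refine Matrix.PosSemidef.of_dotProduct_mulVec_nonneg (Matrix.isHermitian_iff_isSymm.2
      (isSymm_of_tendsto hG fun n => symSqrt_isSymm _)) fun v => ?_
    have := le_quad_of_tendsto hG (a := WithLp.toLp 2 v) (b := 0)
      fun n => quad_nonneg (symSqrt_posSemidef _) _
    simpa [quad] using this
  have hu : CFC.sqrt S₀ = G := CFC.sqrt_unique hGS hG0.nonneg
  change Tendsto _ _ (𝓝 (CFC.sqrt S₀))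
  rw [hu]
  exact hG

/-! ### The score function -/

theorem norm_standardize_sq {P : Measure (Space k)} {φ : Space k → ℝ} (γ : ℝ)
    (hC : (trimCov P φ).PosDef) (y : Space k) :
    ‖standardize y (theta P γ φ)‖ ^ 2 = trimDist P φ y :=
  (quad_inv_eq_norm_sq hC.posSemidef _).symm

theorem norm_standardize_le_iff {P : Measure (Space k)} [IsProbabilityMeasure P] {φ : Space k → ℝ} {γ : ℝ}
    (hC : (trimCov P φ).PosDef) (y : Space k) :
    ‖standardize y (theta P γ φ)‖ ≤ (theta P γ φ).2.2 ↔ trimDist P φ y ≤ trimRadius P γ φ ^ 2 := by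
  rw [← norm_standardize_sq γ hC]
  exact (pow_le_pow_iff_left₀ (norm_nonneg _) trimRadius_nonneg two_ne_zero).symm

/-- The score with the indicator of the ellipsoid replaced by a weight. -/
noncomputable def weightScore (γ : ℝ) (w : ℝ) (z : Space k) : Param k :=
  (w • z, w • outerSubOne z, w - γ)

theorem score_eq_weightScore (γ : ℝ) (y : Space k) (θ : Param k) :
    score γ y θ = weightScore γ (if ‖standardize y θ‖ ≤ θ.2.2 then 1 else 0)
      (standardize y θ) := by
  unfold score weightScore
  split_ifs <;> simp

theorem continuous_standardize (θ : Param k) : Continuous fun y : Space k => standardize y θ := by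
  unfold standardize
  refine (PiLp.continuous_toLp 2 _).comp ?_
  exact Continuous.matrix_mulVec continuous_const (by fun_prop)

theorem integrable_smul_of_support {P : Measure (Space k)} [IsProbabilityMeasure P]
    {F : Type*} [NormedAddCommGroup F] [NormedSpace ℝ F] {f : Space k → F} (hf : Continuous f)
    {w : Space k → ℝ} {R : ℝ} (hm : Measurable w) (h01 : ∀ y, w y ∈ Set.Icc (0 : ℝ) 1)
    (hs : ∀ᵐ y ∂P, w y ≠ 0 → ‖y‖ ≤ R) : Integrable (fun y => w y • f y) P := by
  obtain ⟨K, hK⟩ := exists_bound_mul_of_support hf.norm R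
  refine Integrable.of_bound
    (hm.aestronglyMeasurable.smul hf.aestronglyMeasurable) K ?_
  filter_upwards [hs] with y hy
  have := hK y (w y) (h01 y) hy
  rwa [norm_mul, norm_norm, mul_comm, ← norm_smul] at this

theorem integrable_weightScore {P : Measure (Space k)} [IsProbabilityMeasure P] (γ : ℝ)
    (θ : Param k) {w : Space k → ℝ} {R : ℝ} (hm : Measurable w)
    (h01 : ∀ y, w y ∈ Set.Icc (0 : ℝ) 1) (hs : ∀ᵐ y ∂P, w y ≠ 0 → ‖y‖ ≤ R) :
    Integrable (fun y => weightScore γ (w y) (standardize y θ)) P := by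
  refine (integrable_smul_of_support (continuous_standardize θ) hm h01 hs).prodMk
    ((integrable_smul_of_support (continuous_outerSubOne.comp (continuous_standardize θ))
      hm h01 hs).prodMk ?_)
  exact (integrable_of_mem_Icc hm h01).sub (integrable_const γ)

theorem integrable_score {P Q : Measure (Space k)} [IsProbabilityMeasure P]
    [IsProbabilityMeasure Q] {γ : ℝ} {φ : Space k → ℝ} (hC : (trimCov Q φ).PosDef) :
    Integrable (fun y => score γ y (theta Q γ φ)) P := by
  simp only [score_eq_weightScore]
  refine integrable_weightScore γ (theta Q γ φ)
    (R := ‖trimMean Q φ‖ + (1 + (trimCov Q φ).trace * trimRadius Q γ φ ^ 2)) ?_ ?_ ?_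
  · exact Measurable.ite (measurableSet_le (continuous_standardize _).norm.measurable
      measurable_const) measurable_const measurable_const
  · intro y
    split_ifs <;> simp
  · refine Eventually.of_forall fun y hy => ?_
    have h1 : ‖standardize y (theta Q γ φ)‖ ≤ (theta Q γ φ).2.2 := by
      by_contra hcon
      simp [hcon] at hy
    exact norm_le_of_quad_inv_le hC ((norm_standardize_le_iff hC y).1 h1)

section Estimating

variable {P : Measure (Space k)} [IsProbabilityMeasure P] {γ : ℝ} {φ : Space k → ℝ}

theorem IsStep.support (h : IsStep P γ φ φ) (hC : (trimCov P φ).PosDef) :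
    ∀ᵐ y ∂P, φ y ≠ 0 →
      ‖y‖ ≤ ‖trimMean P φ‖ + (1 + (trimCov P φ).trace * trimRadius P γ φ ^ 2) := by
  filter_upwards [h.eq_zero] with y hy hne
  refine norm_le_of_quad_inv_le hC ?_
  by_contra hcon
  exact hne (hy (not_le.1 hcon))

/-- Off the null boundary `φ` is the indicator of its ellipsoid, so integrals of the score reduce to
moments of `φ`. -/
theorem IsStep.score_eq (h : IsStep P γ φ φ) (hC : (trimCov P φ).PosDef)
    (hb : P {y | trimDist P φ y = trimRadius P γ φ ^ 2} = 0) :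
    ∀ᵐ y ∂P, score γ y (theta P γ φ) = weightScore γ (φ y) (standardize y (theta P γ φ)) := by
  rw [measure_eq_zero_iff_ae_notMem] at hb
  filter_upwards [hb, h.eq_one, h.eq_zero] with y h1 h2 h3
  rw [score_eq_weightScore]
  have h1' : trimDist P φ y ≠ trimRadius P γ φ ^ 2 := h1
  congr 1
  simp only [norm_standardize_le_iff hC]
  rcases lt_or_gt_of_ne h1' with hy | hy
  · rw [h2 hy, if_pos hy.le]
  · rw [h3 hy, if_neg (not_le.2 hy)]

theorem integral_smul_sub_trimMean (hγ : 0 < γ) (hφ : φ ∈ trimClass P γ) :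
    ∫ y, φ y • (y - trimMean P φ) ∂P = 0 := by
  simp only [smul_sub]
  rw [integral_sub (integrable_smul_id hφ) ((integrable_trim hφ).smul_const _),
    integral_smul_const, trimMean, smul_inv_smul₀ (integral_trim_pos hγ hφ).ne', sub_self]

theorem integral_smul_standardize (hγ : 0 < γ) (hφ : φ ∈ trimClass P γ) :
    ∫ y, φ y • standardize y (theta P γ φ) ∂P = 0 := by
  set L : Space k →L[ℝ] Space k := LinearMap.toContinuousLinearMap
    (Matrix.toEuclideanLin (symSqrt (trimCov P φ)).mat⁻¹)
  have h1 : ∀ y, φ y • standardize y (theta P γ φ) = L (φ y • (y - trimMean P φ)) := by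
    intro y
    rw [map_smul]
    rfl
  simp only [h1]
  have hint : Integrable (fun y => φ y • (y - trimMean P φ)) P := by
    simp only [smul_sub]
    exact (integrable_smul_id hφ).sub ((integrable_trim hφ).smul_const _)
  rw [L.integral_comp_comm hint, integral_smul_sub_trimMean hγ hφ, map_zero]

theorem quad_vecMulVec (a b : Fin k → ℝ) (v : Space k) :
    quad (Matrix.vecMulVec a b) v = (a ⬝ᵥ v.ofLp) * (b ⬝ᵥ v.ofLp) := by
  simp only [quad_eq_sum, Matrix.vecMulVec_apply, dotProduct, Finset.sum_mul_sum]
  refine Finset.sum_congr rfl fun i _ => Finset.sum_congr rfl fun j _ => by ring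

theorem trace_vecMulVec_mul (a b : Fin k → ℝ) (S : Matrix (Fin k) (Fin k) ℝ) :
    (Matrix.vecMulVec a b * S).trace = b ⬝ᵥ (S *ᵥ a) := by
  rw [Matrix.vecMulVec_eq Unit, Matrix.mul_assoc, Matrix.trace_mul_comm]
  simp [Matrix.trace, Matrix.mul_assoc, Matrix.mul_apply, dotProduct, Matrix.mulVec,
    Finset.mul_sum]

/-- Standardizing by the square root whitens the trimmed distribution: `G⁻¹ C_P(φ) G⁻¹ = 1`. -/
theorem integral_smul_outerSubOne (hγ : 0 < γ) (h : IsStep P γ φ φ) (hC : (trimCov P φ).PosDef) :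
    ∫ y, φ y • outerSubOne (standardize y (theta P γ φ)) ∂P = 0 := by
  have hφ := h.mem
  have hint : Integrable (fun y => φ y • outerSubOne (standardize y (theta P γ φ))) P :=
    integrable_smul_of_support (continuous_outerSubOne.comp (continuous_standardize _))
      hφ.1 hφ.2.1 (h.support hC)
  have : CompleteSpace (SymMat k) := FiniteDimensional.complete ℝ _
  refine SymMat.ext_entry fun i j => ?_
  rw [← (SymMat.entry i j).integral_comp_comm hint, map_zero]
  set A := (symSqrt (trimCov P φ)).mat⁻¹ with hA
  have e1 : ∀ y, SymMat.entry i j (φ y • outerSubOne (standardize y (theta P γ φ))) =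
      quad (Matrix.vecMulVec (A i) (A j)) (y - trimMean P φ) * φ y
        - (1 : Matrix (Fin k) (Fin k) ℝ) i j * φ y := by
    intro y
    rw [map_smul, quad_vecMulVec]
    change φ y * ((A *ᵥ (y - trimMean P φ).ofLp) i * (A *ᵥ (y - trimMean P φ).ofLp) j - _) = _
    simp only [Matrix.mulVec]
    ring
  simp only [e1]
  rw [integral_sub (integrable_quad_mul hφ _ _) ((integrable_trim hφ).const_mul _),
    integral_const_mul, integral_quad_mul hγ hφ, trace_vecMulVec_mul]
  have e2 : A * trimCov P φ * A = 1 := by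
    have hu := isUnit_symSqrt hC
    conv_lhs => rw [← symSqrt_mul_self hC.posSemidef]
    rw [hA, ← mul_assoc, Matrix.nonsing_inv_mul _ hu, one_mul, Matrix.mul_nonsing_inv _ hu]
  have e3 : A j ⬝ᵥ (trimCov P φ *ᵥ A i) = (A * trimCov P φ * A) j i := by
    rw [mul_assoc, Matrix.mul_apply]
    refine Finset.sum_congr rfl fun l _ => ?_
    have e : (trimCov P φ *ᵥ A i) l = (trimCov P φ * A) l i := by
      simp only [Matrix.mulVec, dotProduct, Matrix.mul_apply]
      refine Finset.sum_congr rfl fun p _ => ?_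
      exact congrArg (trimCov P φ l p * ·) ((symSqrt_inv_isSymm (trimCov P φ)).apply p i)
    rw [e]
  have e4 : quad (Matrix.vecMulVec (A i) (A j)) (trimMean P φ - trimMean P φ) = 0 := by
    simp [quad]
  rw [e3, e2, e4, Matrix.one_apply, Matrix.one_apply]
  simp only [eq_comm (a := i)]
  ring

/-- The estimating equations for the parameter of a concentrated trimming function. -/
theorem IsStep.meanScore_eq_zero (hγ : 0 < γ) (h : IsStep P γ φ φ) (hC : (trimCov P φ).PosDef)
    (hb : P {y | trimDist P φ y = trimRadius P γ φ ^ 2} = 0) :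
    meanScore P γ (theta P γ φ) = 0 := by
  have hφ := h.mem
  have : CompleteSpace (SymMat k) := FiniteDimensional.complete ℝ _
  rw [meanScore, integral_congr_ae (h.score_eq hC hb)]
  have i1 := integrable_smul_of_support (continuous_standardize (theta P γ φ)) hφ.1 hφ.2.1
    (h.support hC)
  have i2 := integrable_smul_of_support
    (continuous_outerSubOne.comp (continuous_standardize (theta P γ φ))) hφ.1 hφ.2.1 (h.support hC)
  have i3 : Integrable (fun y => φ y - γ) P := (integrable_trim hφ).sub (integrable_const γ)
  simp only [weightScore]
  have e1 := integral_pair i1 (i2.prodMk i3)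
  have e2 := integral_pair i2 i3
  refine e1.trans ?_
  rw [integral_smul_standardize hγ hφ]
  refine Prod.ext rfl (e2.trans ?_)
  refine Prod.ext (integral_smul_outerSubOne hγ h hC) ?_
  change ∫ y, (φ y - γ) ∂P = 0
  rw [integral_sub (integrable_trim hφ) (integrable_const γ), h.integral_eq]
  simp

end Estimating

theorem tendsto_standardize {ι : Type*} {l : Filter ι} {θ : ι → Param k} {θ₀ : Param k}
    (x : Space k) (h : Tendsto θ l (𝓝 θ₀)) (hdet : θ₀.2.1.mat.det ≠ 0) :
    Tendsto (fun n => standardize x (θ n)) l (𝓝 (standardize x θ₀)) := by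
  have h1 : Tendsto (fun n => (θ n).1) l (𝓝 θ₀.1) := (continuous_fst.tendsto _).comp h
  have h2 : Tendsto (fun n => (θ n).2.1.mat) l (𝓝 θ₀.2.1.mat) :=
    ((continuous_mat.comp (continuous_fst.comp continuous_snd)).tendsto _).comp h
  have e1 : Continuous fun p : Matrix (Fin k) (Fin k) ℝ × Space k =>
      WithLp.toLp 2 (p.1 *ᵥ (x - p.2).ofLp) :=
    (PiLp.continuous_toLp 2 _).comp (Continuous.matrix_mulVec continuous_fst (by fun_prop))
  have e2 : Tendsto (fun n => ((θ n).2.1.mat⁻¹, (θ n).1)) l (𝓝 (θ₀.2.1.mat⁻¹, θ₀.1)) :=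
    (tendsto_matrix_inv hdet h2).prodMk_nhds h1
  exact (e1.tendsto _).comp e2

theorem tendsto_score {ι : Type*} {l : Filter ι} {θ : ι → Param k} {θ₀ : Param k} (γ : ℝ)
    (x : Space k) (h : Tendsto θ l (𝓝 θ₀)) (hdet : θ₀.2.1.mat.det ≠ 0)
    (hne : ‖standardize x θ₀‖ ≠ θ₀.2.2) :
    Tendsto (fun n => score γ x (θ n)) l (𝓝 (score γ x θ₀)) := by
  have h3 : Tendsto (fun n => (θ n).2.2) l (𝓝 θ₀.2.2) :=
    ((continuous_snd.comp continuous_snd).tendsto _).comp h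
  have h4 := tendsto_standardize x h hdet
  have hw : Tendsto (fun n => if ‖standardize x (θ n)‖ ≤ (θ n).2.2 then (1 : ℝ) else 0) l
      (𝓝 (if ‖standardize x θ₀‖ ≤ θ₀.2.2 then 1 else 0)) := by
    refine tendsto_const_nhds.congr' ?_
    rcases lt_or_gt_of_ne hne with hlt | hlt
    · filter_upwards [h4.norm.eventually_lt h3 hlt] with n hn
      rw [if_pos hlt.le, if_pos hn.le]
    · filter_upwards [h3.eventually_lt h4.norm hlt] with n hn
      rw [if_neg (not_le.2 hlt), if_neg (not_le.2 hn)]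
  simp only [score_eq_weightScore, weightScore]
  exact (hw.smul h4).prodMk_nhds ((hw.smul ((continuous_outerSubOne.tendsto _).comp h4)).prodMk_nhds
    (hw.sub tendsto_const_nhds))

/-! ### Zeros of perturbed equations -/

/-- The derivative of the zero of a perturbed equation. -/
theorem tendsto_diff_quotient_of_zero {E : Type*} [NormedAddCommGroup E] [NormedSpace ℝ E]
    {D : E ≃L[ℝ] E} {f : E → E} {θ₀ : E} (hf : HasFDerivAt f (D : E →L[ℝ] E) θ₀) (h0 : f θ₀ = 0)
    {θ g : ℝ → E} {g₀ : E} (hθ : Tendsto θ (𝓝[>] 0) (𝓝 θ₀)) (hg : Tendsto g (𝓝[>] 0) (𝓝 g₀))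
    (heq : ∀ᶠ ε in 𝓝[>] (0 : ℝ), (1 - ε) • f (θ ε) + ε • g ε = 0) :
    Tendsto (fun ε : ℝ => ε⁻¹ • (θ ε - θ₀)) (𝓝[>] 0) (𝓝 (-D.symm g₀)) := by
  have hid : Tendsto (fun ε : ℝ => ε) (𝓝[>] 0) (𝓝 0) := tendsto_id.mono_left nhdsWithin_le_nhds
  set v : ℝ → E := fun ε => -((1 - ε)⁻¹ • g ε) with hv
  have hvl : Tendsto v (𝓝[>] 0) (𝓝 (-g₀)) := by
    have h1 : Tendsto (fun ε : ℝ => (1 - ε)⁻¹) (𝓝[>] 0) (𝓝 (1 - 0)⁻¹) :=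
      (tendsto_const_nhds.sub hid).inv₀ (by norm_num)
    simpa [hv] using (h1.smul hg).neg
  have hfv : ∀ᶠ ε in 𝓝[>] (0 : ℝ), f (θ ε) = ε • v ε := by
    filter_upwards [heq, hid.eventually (gt_mem_nhds one_pos)] with ε h1 h2
    have h3 : (1 - ε) ≠ 0 := by linarith
    have h4 : (1 - ε) • f (θ ε) = -(ε • g ε) := eq_neg_of_add_eq_zero_left h1
    rw [hv, ← inv_smul_smul₀ h3 (f (θ ε)), h4]
    simp only [smul_neg, smul_smul, mul_comm]
  have hrem : (fun ε => f (θ ε) - D (θ ε - θ₀)) =o[𝓝[>] 0] fun ε => θ ε - θ₀ := by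
    have h1 := hf.isLittleO.comp_tendsto hθ
    refine h1.congr' (Eventually.of_forall fun ε => ?_) (Eventually.of_forall fun ε => rfl)
    simp [Function.comp, h0]
  have hrem' : (fun ε => D.symm (f (θ ε)) - (θ ε - θ₀)) =o[𝓝[>] 0] fun ε => θ ε - θ₀ := by
    have h1 := ((D.symm : E →L[ℝ] E).isBigO_comp (fun ε => f (θ ε) - D (θ ε - θ₀))
      (𝓝[>] 0)).trans_isLittleO hrem
    refine h1.congr' (Eventually.of_forall fun ε => ?_) (Eventually.of_forall fun ε => rfl)
    simp
  -- Convergence is upgraded to a rate: `θ ε - θ₀` differs from `D⁻¹ f(θ ε)` by `o(θ ε - θ₀)`, hence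
  -- is controlled by it, and `f(θ ε) = ε • v ε` with `v` convergent.
  have hO : (fun ε => θ ε - θ₀) =O[𝓝[>] 0] fun ε : ℝ => ε := by
    have h1 : (fun ε => θ ε - θ₀) =O[𝓝[>] 0] fun ε => D.symm (f (θ ε)) := by
      simpa using hrem'.right_isBigO_add
    refine h1.trans (((D.symm : E →L[ℝ] E).isBigO_comp _ _).trans ?_)
    have h2 : (fun ε : ℝ => ε • v ε) =O[𝓝[>] 0] fun ε : ℝ => ε • (1 : ℝ) :=
      (Asymptotics.isBigO_refl _ _).smul (hvl.isBigO_one ℝ)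
    simp only [smul_eq_mul, mul_one] at h2
    exact h2.congr' (hfv.mono fun ε h => h.symm) EventuallyEq.rfl
  have ho : (fun ε => D.symm (f (θ ε)) - (θ ε - θ₀)) =o[𝓝[>] 0] fun ε : ℝ => ε :=
    hrem'.trans_isBigO hO
  have hlim : Tendsto (fun ε : ℝ => ε⁻¹ • (D.symm (f (θ ε)) - (θ ε - θ₀))) (𝓝[>] 0) (𝓝 0) :=
    ho.tendsto_inv_smul_nhds_zero
  have hDv : Tendsto (fun ε => D.symm (v ε)) (𝓝[>] 0) (𝓝 (D.symm (-g₀))) :=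
    (D.symm.continuous.tendsto _).comp hvl
  have hsub := hDv.sub hlim
  rw [sub_zero, map_neg] at hsub
  refine hsub.congr' ?_
  filter_upwards [hfv, self_mem_nhdsWithin] with ε h1 h2
  have h3 : ε ≠ 0 := (show (0 : ℝ) < ε from h2).ne'
  rw [h1, map_smul, smul_sub, inv_smul_smul₀ h3, sub_sub_cancel]

/-! ### Competitors for the perturbed problem and continuity of the functional -/

theorem trimMean_congr_ae {P : Measure (Space k)} {φ ψ : Space k → ℝ} (h : φ =ᵐ[P] ψ) :
    trimMean P φ = trimMean P ψ := by
  rw [trimMean, trimMean, integral_congr_ae h,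
    integral_congr_ae (h.mono fun y hy => congrArg (· • y) hy :
      (fun y => φ y • y) =ᵐ[P] fun y => ψ y • y)]

theorem trimCov_congr_ae {P : Measure (Space k)} {φ ψ : Space k → ℝ} (h : φ =ᵐ[P] ψ) :
    trimCov P φ = trimCov P ψ := by
  ext i j
  simp only [trimCov, Matrix.of_apply, trimMean_congr_ae h, integral_congr_ae h]
  congr 1
  refine integral_congr_ae (h.mono fun y hy => ?_)
  simp only [hy]

theorem measurableSet_ellipsoid (m : Space k) (S : Matrix (Fin k) (Fin k) ℝ) (s : ℝ) :
    MeasurableSet (ellipsoid m S s) :=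
  measurableSet_le ((continuous_quad S⁻¹).comp (by fun_prop :
    Continuous fun y : Space k => y - m)).measurable measurable_const

theorem indicator_ellipsoid_mem {P : Measure (Space k)} [IsProbabilityMeasure P] {γ : ℝ}
    {m : Space k} {S : Matrix (Fin k) (Fin k) ℝ} (hS : S.PosDef) {s : ℝ}
    (h : γ ≤ P.real (ellipsoid m S s)) : (ellipsoid m S s).indicator 1 ∈ trimClass P γ := by
  have hm := measurableSet_ellipsoid m S s
  refine mem_trimClass_of_support (R := ‖m‖ + (1 + S.trace * s ^ 2))
    (measurable_one.indicator hm) (fun y => ?_) (fun y hy => ?_) ?_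
  · by_cases hy : y ∈ ellipsoid m S s <;> simp [hy]
  · exact norm_le_of_quad_inv_le hS (mem_ellipsoid.1 (Set.mem_of_indicator_ne_zero hy))
  · rwa [integral_indicator_one hm]

theorem tendsto_indicator_ellipsoid {m : Space k} {S : Matrix (Fin k) (Fin k) ℝ} {r : ℝ}
    (hr : 0 ≤ r) (y : Space k) :
    Tendsto (fun d : ℝ => (ellipsoid m S (r + d)).indicator (1 : Space k → ℝ) y) (𝓝[>] 0)
      (𝓝 ((ellipsoid m S r).indicator 1 y)) := by
  refine tendsto_const_nhds.congr' ?_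
  by_cases hy : quad S⁻¹ (y - m) ≤ r ^ 2
  · filter_upwards [self_mem_nhdsWithin] with d hd
    have hd' : (0 : ℝ) < d := hd
    have h1 : y ∈ ellipsoid m S (r + d) := mem_ellipsoid.2
      (hy.trans (pow_le_pow_left₀ hr (by linarith) 2))
    have h2 : y ∈ ellipsoid m S r := mem_ellipsoid.2 hy
    simp [h1, h2]
  · have hl : Tendsto (fun d : ℝ => (r + d) ^ 2) (𝓝[>] 0) (𝓝 ((r + 0) ^ 2)) :=
      (Continuous.tendsto (by fun_prop) 0).mono_left nhdsWithin_le_nhds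
    rw [add_zero] at hl
    filter_upwards [hl.eventually (gt_mem_nhds (not_le.1 hy))] with d hd
    have h1 : y ∉ ellipsoid m S (r + d) := fun h => absurd (mem_ellipsoid.1 h) (not_le.2 hd)
    have h2 : y ∉ ellipsoid m S r := fun h => hy (mem_ellipsoid.1 h)
    simp [h1, h2]

theorem ellipsoid_norm_bound {m : Space k} {S : Matrix (Fin k) (Fin k) ℝ} (hS : S.PosDef) {s t : ℝ}
    (hs : 0 ≤ s) (hst : s ≤ t) {y : Space k}
    (hy : (ellipsoid m S s).indicator (1 : Space k → ℝ) y ≠ 0) :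
    ‖y‖ ≤ ‖m‖ + (1 + S.trace * t ^ 2) :=
  norm_le_of_quad_inv_le hS ((mem_ellipsoid.1 (Set.mem_of_indicator_ne_zero hy)).trans
    (pow_le_pow_left₀ hs hst 2))

theorem tendsto_det_of_tendsto {ι : Type*} {l : Filter ι} {C : ι → Matrix (Fin k) (Fin k) ℝ}
    {S : Matrix (Fin k) (Fin k) ℝ} (h : Tendsto C l (𝓝 S)) :
    Tendsto (fun n => (C n).det) l (𝓝 S.det) :=
  (Continuous.matrix_det continuous_id).continuousAt.tendsto.comp h

theorem eventually_mem_Icc {e : ℝ} (he : 0 < e) : ∀ᶠ ε in 𝓝[>] (0 : ℝ), ε ∈ Set.Icc 0 e := by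
  filter_upwards [Ioc_mem_nhdsGT he] with ε hε using ⟨hε.1.le, hε.2⟩

theorem mass_boundary_eq_zero {P Q : Measure (Space k)} {γ : ℝ} {φ : Space k → ℝ}
    (hnull : ∀ (m : Space k) (S : Matrix (Fin k) (Fin k) ℝ) (s : ℝ), S.PosDef → 0 < s →
      P {y | quad S⁻¹ (y - m) = s ^ 2} = 0) (hC : (trimCov Q φ).PosDef)
    (hr : 0 < trimRadius Q γ φ) : P {y | trimDist Q φ y = trimRadius Q γ φ ^ 2} = 0 :=
  hnull _ _ _ hC hr

/-- Competitors for the perturbed problem with almost minimal determinant. -/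
theorem eventually_exists_det_le {P : Measure (Space k)} [IsProbabilityMeasure P] (x : Space k)
    {γ : ℝ} (hγ : 0 < γ) (hγ1 : γ < 1) {φ₀ : Space k → ℝ} (hC : (trimCov P φ₀).PosDef)
    (hstep : IsStep P γ φ₀ φ₀)
    (hb : P {y | trimDist P φ₀ y = trimRadius P γ φ₀ ^ 2} = 0)
    (hout : ∀ ε : ℝ, 0 < ε → γ < P.real (ellipsoid (trimMean P φ₀) (trimCov P φ₀)
      (trimRadius P γ φ₀ + ε))) {η : ℝ} (hη : 0 < η) :
    ∀ᶠ ε in 𝓝[>] (0 : ℝ), ∃ ψ ∈ trimClass (perturb P x ε) γ,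
      (trimCov (perturb P x ε) ψ).det ≤ (trimCov P φ₀).det + η := by
  set m := trimMean P φ₀ with hm
  set S := trimCov P φ₀ with hSdef
  set r := trimRadius P γ φ₀ with hr
  have hr0 : 0 ≤ r := trimRadius_nonneg
  have hfix : Tendsto (fun ε : ℝ => ε) (𝓝[>] 0) (𝓝 0) := tendsto_id.mono_left nhdsWithin_le_nhds
  have hae : φ₀ =ᵐ[P] (ellipsoid m S r).indicator 1 := by
    rw [measure_eq_zero_iff_ae_notMem] at hb
    filter_upwards [hb, hstep.eq_one, hstep.eq_zero] with y h1 h2 h3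
    have h1' : trimDist P φ₀ y ≠ r ^ 2 := h1
    rcases lt_or_gt_of_ne h1' with hy | hy
    · have : y ∈ ellipsoid m S r := mem_ellipsoid.2 hy.le
      simp [h2 hy, this]
    · have : y ∉ ellipsoid m S r := fun h => absurd (mem_ellipsoid.1 h) (not_le.2 hy)
      simp [h3 hy, this]
  have hmass : γ ≤ P.real (ellipsoid m S r) := le_mass_trimRadius (P := P) (φ := φ₀) hγ1
  -- The optimal ellipsoid may have mass exactly `γ` and become inadmissible after contamination. A
  -- slightly larger one has mass above `γ` and nearly the same determinant; `d` is fixed first,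
  -- then `ε` tends to `0`.
  have h1 : Tendsto (fun d => trimCov P ((ellipsoid m S (r + d)).indicator 1)) (𝓝[>] 0) (𝓝 S) := by
    have h2 := (tendsto_trimMean_trimCov (P := P) (x := x) (γ := γ) (l := 𝓝[>] (0 : ℝ))
      (R := ‖m‖ + (1 + S.trace * (r + 1) ^ 2)) (ε := fun _ => 0) (ε₀ := 0)
      (ψ := fun d => (ellipsoid m S (r + d)).indicator 1) (ψ₀ := (ellipsoid m S r).indicator 1) hγ
      (Eventually.of_forall fun _ => by simp) tendsto_const_nhds ?_ ?_ ?_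
      (Eventually.of_forall fun y => tendsto_indicator_ellipsoid hr0 y)
      (tendsto_indicator_ellipsoid hr0 x)).2
    · simp only [perturb_zero] at h2
      rwa [← trimCov_congr_ae hae] at h2
    · filter_upwards [self_mem_nhdsWithin] with d hd
      rw [perturb_zero]
      exact indicator_ellipsoid_mem hC (hout d hd).le
    · rw [perturb_zero]
      exact indicator_ellipsoid_mem hC hmass
    · filter_upwards [Ioc_mem_nhdsGT (one_pos : (0 : ℝ) < 1)] with d hd
      exact Eventually.of_forall fun y hy =>
        ellipsoid_norm_bound hC (by linarith [hd.1]) (by linarith [hd.2]) hy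
  have h3 := (tendsto_det_of_tendsto h1).eventually (gt_mem_nhds (show S.det < S.det + η by linarith))
  obtain ⟨d, hd, hd0⟩ := (h3.and self_mem_nhdsWithin).exists
  have hd0' : (0 : ℝ) < d := hd0
  set ψ : Space k → ℝ := (ellipsoid m S (r + d)).indicator 1 with hψ
  have hmassd : γ < P.real (ellipsoid m S (r + d)) := hout d hd0'
  have hmem : ∀ᶠ ε in 𝓝[>] (0 : ℝ), ψ ∈ trimClass (perturb P x ε) γ := by
    have h4 : Tendsto (fun ε : ℝ => (1 - ε) * P.real (ellipsoid m S (r + d))) (𝓝[>] 0)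
        (𝓝 ((1 - 0) * P.real (ellipsoid m S (r + d)))) :=
      (tendsto_const_nhds.sub hfix).mul tendsto_const_nhds
    rw [sub_zero, one_mul] at h4
    filter_upwards [h4.eventually (lt_mem_nhds hmassd), eventually_mem_Icc one_pos] with ε hε h01
    have := isProbabilityMeasure_perturb P x h01
    exact indicator_ellipsoid_mem hC (hε.le.trans (le_perturb_real h01 _))
  have h5 := (tendsto_trimMean_trimCov (P := P) (x := x) (γ := γ) (l := 𝓝[>] (0 : ℝ))
      (R := ‖m‖ + (1 + S.trace * (r + d) ^ 2)) (ε := fun ε => ε) (ε₀ := 0)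
      (ψ := fun _ => ψ) (ψ₀ := ψ) hγ (eventually_mem_Icc one_pos) hfix hmem (by
        rw [perturb_zero]; exact indicator_ellipsoid_mem hC hmassd.le)
      (Eventually.of_forall fun _ => Eventually.of_forall fun y hy =>
        ellipsoid_norm_bound hC (by linarith) le_rfl hy)
      (Eventually.of_forall fun y => tendsto_const_nhds) tendsto_const_nhds).2
  rw [perturb_zero] at h5
  filter_upwards [hmem, (tendsto_det_of_tendsto h5).eventually (gt_mem_nhds hd)] with ε h6 h7
  exact ⟨ψ, h6, h7.le⟩

/-- The boundary of an ellipsoid is null for `P`, so it has perturbed mass at most `ε < γ`, even if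
it passes through `x`; this is what `IsMinimizing.isStep` requires. -/
theorem isStep_of_isMinimizing_perturb (hk : 1 ≤ k) {P : Measure (Space k)}
    [IsProbabilityMeasure P] (x : Space k) {γ δ τ R ε : ℝ} (hγ : 0 < γ) (hγ1 : γ < 1) (hδ : 0 < δ)
    (hτ : 0 < τ) (hε : ε ∈ Set.Icc (0 : ℝ) 1) (hεγ : ε < γ)
    (htame : Tame (perturb P x ε) γ δ τ R)
    (hnull : ∀ (m : Space k) (S : Matrix (Fin k) (Fin k) ℝ) (s : ℝ), S.PosDef → 0 < s →
      P {y | quad S⁻¹ (y - m) = s ^ 2} = 0) {φ : Space k → ℝ}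
    (h : IsMinimizing (perturb P x ε) γ φ) :
    (trimCov (perturb P x ε) φ).PosDef ∧ 0 < trimRadius (perturb P x ε) γ φ ∧
      IsStep (perturb P x ε) γ φ φ := by
  have := isProbabilityMeasure_perturb P x hε
  have hC := htame.posDef hγ hδ hτ h.1
  have hr : 0 < trimRadius (perturb P x ε) γ φ := by
    refine lt_of_le_of_ne trimRadius_nonneg fun h0 => ?_
    have := htame.le_trace_mul_sq hk hγ hγ1 hδ hτ h.1
    rw [← h0] at this
    nlinarith [pow_pos hδ 2]
  refine ⟨hC, hr, h.isStep hγ hγ1 hC ((perturb_real_le hε _).trans_lt ?_)⟩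
  rw [Measure.real, mass_boundary_eq_zero hnull hC hr]
  simpa using hεγ

/-- Continuity of the MCD functional along the perturbed measures. -/
theorem tendsto_theta_perturb (hk : 1 ≤ k) {P : Measure (Space k)}
    [IsProbabilityMeasure P] (x : Space k) {γ δ τ R e : ℝ} (hγ : 0 < γ) (hγ1 : γ < 1) (hδ : 0 < δ)
    (hτ : 0 < τ) (hR : 0 < R) (he : 0 < e) (he1 : e < 1) (heγ : e < γ)
    (htame : ∀ ε ∈ Set.Icc 0 e, Tame (perturb P x ε) γ δ τ R)
    (hnull : ∀ (m : Space k) (S : Matrix (Fin k) (Fin k) ℝ) (s : ℝ), S.PosDef → 0 < s →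
      P {y | quad S⁻¹ (y - m) = s ^ 2} = 0)
    {φ₀ : Space k → ℝ} (hφ₀ : IsMinimizing P γ φ₀)
    (huniq : ∀ φ, IsMinimizing P γ φ →
      trimMean P φ = trimMean P φ₀ ∧ trimCov P φ = trimCov P φ₀)
    (hout : ∀ ε : ℝ, 0 < ε → γ < P.real (ellipsoid (trimMean P φ₀) (trimCov P φ₀)
      (trimRadius P γ φ₀ + ε))) {φ : ℝ → Space k → ℝ}
    (hφ : ∀ᶠ ε in 𝓝[>] (0 : ℝ), IsMinimizing (perturb P x ε) γ (φ ε)) :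
    Tendsto (fun ε => theta (perturb P x ε) γ (φ ε)) (𝓝[>] 0) (𝓝 (theta P γ φ₀)) := by
  obtain ⟨hC₀, hr₀, hstep₀⟩ := isStep_of_isMinimizing_perturb (ε := 0) hk x hγ hγ1 hδ hτ
    (by simp) hγ (htame 0 ⟨le_rfl, he.le⟩) hnull (φ := φ₀) (by rwa [perturb_zero])
  rw [perturb_zero] at hC₀ hr₀ hstep₀
  have hcomp : ∀ η : ℝ, 0 < η → ∀ᶠ ε in 𝓝[>] (0 : ℝ),
      (trimCov (perturb P x ε) (φ ε)).det ≤ (trimCov P φ₀).det + η := by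
    intro η hη
    filter_upwards [hφ, eventually_exists_det_le x hγ hγ1 hC₀ hstep₀
      (mass_boundary_eq_zero hnull hC₀ hr₀) hout hη] with ε h1 ⟨ψ, h2, h3⟩
    exact (h1.2 ψ h2).trans h3
  refine tendsto_of_subseq_tendsto fun ns hns => ?_
  obtain ⟨N, hN⟩ := eventually_atTop.1
    (hns.eventually (hφ.and ((eventually_mem_Icc he).and (hcomp 1 one_pos))))
  have hge : ∀ n, N ≤ n + N := fun n => Nat.le_add_left _ _
  have h01 : ∀ n, ns (n + N) ∈ Set.Icc (0 : ℝ) 1 := fun n =>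
    ⟨(hN _ (hge n)).2.1.1, (hN _ (hge n)).2.1.2.trans he1.le⟩
  have hst := fun n => isStep_of_isMinimizing_perturb hk x hγ hγ1 hδ hτ (h01 n)
    ((hN _ (hge n)).2.1.2.trans_lt heγ) (htame _ (hN _ (hge n)).2.1) hnull (hN _ (hge n)).1
  have hnsN : Tendsto (fun n => ns (n + N)) atTop (𝓝[>] 0) :=
    hns.comp (tendsto_atTop_mono (fun n => Nat.le_add_right n N) tendsto_id)
  have hprob : ∀ n, IsProbabilityMeasure (perturb P x (ns (n + N))) := fun n =>
    isProbabilityMeasure_perturb P x (h01 n)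
  obtain ⟨σ, m, S, r, ψ₀, hσ, hS, hr, hT, hCl, hrl, hmem, hint, hψae, hT', hC'⟩ :=
    exists_subseq_isStep hk x hγ hγ1 hδ hτ hR he1 htame hnull (M := (trimCov P φ₀).det + 1)
      (ε := fun n => ns (n + N)) (ε₀ := 0) (φ := fun n => φ (ns (n + N)))
      (ψ := fun n => φ (ns (n + N))) (fun n => (hN _ (hge n)).2.1)
      (hnsN.mono_right nhdsWithin_le_nhds) (fun n => (hN _ (hge n)).1.1)
      (fun n => (hN _ (hge n)).2.2) (fun n => (hst n).2.2)
  rw [perturb_zero] at hmem hint hT' hC'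
  -- The minimizers are their own steps, so the limits of the ellipsoid parameters are also the
  -- moments of the limit function `ψ₀`.
  have eT : trimMean P ψ₀ = m := tendsto_nhds_unique hT' hT
  have eC : trimCov P ψ₀ = S := tendsto_nhds_unique hC' hCl
  have hdet : S.det ≤ (trimCov P φ₀).det := by
    refine le_of_forall_pos_le_add fun η hη => ?_
    refine le_of_tendsto (tendsto_det_of_tendsto hCl) ?_
    exact (hnsN.comp hσ.tendsto_atTop).eventually (hcomp η hη)
  have hmin : IsMinimizing P γ ψ₀ := ⟨hmem, fun χ hχ => by
    rw [eC]; exact hdet.trans (hφ₀.2 χ hχ)⟩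
  obtain ⟨u1, u2⟩ := huniq ψ₀ hmin
  rw [eT] at u1
  rw [eC] at u2
  have hmassr : P.real (ellipsoid (trimMean P φ₀) (trimCov P φ₀) r) = γ := by
    rw [← u1, ← u2, ← hint, integral_congr_ae hψae,
      integral_indicator_one (measurableSet_ellipsoid m S r)]
  -- The limiting ellipsoid has mass exactly `γ`, while every radius beyond `r_P(φ₀)` gives more by
  -- `hout`.
  have er : r = trimRadius P γ φ₀ := by
    refine le_antisymm ?_ (trimRadius_le hr hmassr.ge)
    by_contra hcon
    push Not at hcon
    have h1 := hout (r - trimRadius P γ φ₀) (by linarith)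
    rw [add_sub_cancel, hmassr] at h1
    exact lt_irrefl _ h1
  refine ⟨fun n => σ n + N, ?_⟩
  subst u1 u2 er
  exact hT.prodMk_nhds ((tendsto_symSqrt
    (Eventually.of_forall fun n => (hst (σ n)).1.posSemidef) hCl).prodMk_nhds hrl)

end MCD

/-! ### The influence function -/

theorem mainTheorem2 (k : ℕ) (hk : 1 ≤ k) (γ : ℝ) (hγ0 : 0 < γ) (hγ1 : γ ≤ 1)
    (P₀ : Measure (EuclideanSpace ℝ (Fin k))) [IsProbabilityMeasure P₀]
    -- every hyperplane has mass less than `γ`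
    (hyper : ∀ (a : EuclideanSpace ℝ (Fin k)) (b : ℝ), a ≠ 0 →
      P₀.real {y | inner ℝ a y = b} < γ)
    -- the boundary of every ellipsoid has mass zero
    (hbdry : ∀ (m : EuclideanSpace ℝ (Fin k)) (S : Matrix (Fin k) (Fin k) ℝ) (s : ℝ),
      S.PosDef → 0 < s → P₀ (frontier (MCD.ellipsoid m S s)) = 0)
    -- the MCD functional at `P₀` is given by `φ₀` and is uniquely defined
    (φ₀ : EuclideanSpace ℝ (Fin k) → ℝ) (hφ₀ : MCD.IsMinimizing P₀ γ φ₀)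
    (huniq : ∀ φ, MCD.IsMinimizing P₀ γ φ →
      MCD.trimMean P₀ φ = MCD.trimMean P₀ φ₀ ∧ MCD.trimCov P₀ φ = MCD.trimCov P₀ φ₀)
    -- there is mass directly outside the minimizing ellipsoid
    (hout : ∀ ε : ℝ, 0 < ε → γ < P₀.real (MCD.ellipsoid (MCD.trimMean P₀ φ₀)
      (MCD.trimCov P₀ φ₀) (MCD.trimRadius P₀ γ φ₀ + ε)))
    -- `Λ` has the non-singular derivative `D` at `θ₀`
    (D : MCD.Param k ≃L[ℝ] MCD.Param k)
    (hD : HasFDerivAt (MCD.meanScore P₀ γ) (D : MCD.Param k →L[ℝ] MCD.Param k)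
      (MCD.theta P₀ γ φ₀))
    (x : EuclideanSpace ℝ (Fin k))
    (hx : x ∉ frontier (MCD.ellipsoid (MCD.trimMean P₀ φ₀) (MCD.trimCov P₀ φ₀)
      (MCD.trimRadius P₀ γ φ₀))) :
    -- for small `ε > 0`, `Θ` is defined at the perturbed measure
    (∀ᶠ ε in 𝓝[>] (0 : ℝ), (∃ φ, MCD.IsMinimizing (MCD.perturb P₀ x ε) γ φ) ∧
      ∀ φ, MCD.IsMinimizing (MCD.perturb P₀ x ε) γ φ →
        (MCD.trimCov (MCD.perturb P₀ x ε) φ).PosDef) ∧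
    -- whatever minimizers are used to define `Θ`, its difference quotient converges
    ∀ φ : ℝ → EuclideanSpace ℝ (Fin k) → ℝ,
      (∀ᶠ ε in 𝓝[>] (0 : ℝ), MCD.IsMinimizing (MCD.perturb P₀ x ε) γ (φ ε)) →
      Tendsto (fun ε : ℝ =>
          ε⁻¹ • (MCD.theta (MCD.perturb P₀ x ε) γ (φ ε) - MCD.theta P₀ γ φ₀))
        (𝓝[>] 0) (𝓝 (-D.symm (MCD.score γ x (MCD.theta P₀ γ φ₀)))) := by
  -- Mass strictly above `γ` outside the ellipsoid excludes `γ = 1`.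
  have hγ1' : γ < 1 := (hout 1 one_pos).trans_le measureReal_le_one
  have hnull : ∀ (m : MCD.Space k) (S : Matrix (Fin k) (Fin k) ℝ) (s : ℝ), S.PosDef → 0 < s →
      P₀ {y | MCD.quad S⁻¹ (y - m) = s ^ 2} = 0 := fun m S s hS hs =>
    measure_mono_null (MCD.setOf_quad_eq_subset_frontier m hs) (hbdry m S s hS hs)
  obtain ⟨e, δ, τ, R, he, he1, heγ, hδ, hτ, hR, htame⟩ :=
    MCD.exists_tame_perturb P₀ x hγ0 hγ1' hyper
  have hIcc := MCD.eventually_mem_Icc he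
  refine ⟨?_, fun φ hφ => ?_⟩
  · filter_upwards [hIcc] with ε hε
    have := MCD.isProbabilityMeasure_perturb P₀ x ⟨hε.1, hε.2.trans he1.le⟩
    exact ⟨MCD.exists_isMinimizing_perturb hk x hγ0 hγ1' hδ hτ hR he1 htame hnull hε,
      fun φ hφ => (htame ε hε).posDef hγ0 hδ hτ hφ.1⟩
  obtain ⟨hC₀, hr₀, hstep₀⟩ := MCD.isStep_of_isMinimizing_perturb (ε := 0) hk x hγ0 hγ1' hδ hτ
    (by simp) hγ0 (htame 0 ⟨le_rfl, he.le⟩) hnull (φ := φ₀) (by rwa [MCD.perturb_zero])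
  rw [MCD.perturb_zero] at hC₀ hr₀ hstep₀
  have hzero := hstep₀.meanScore_eq_zero hγ0 hC₀ (MCD.mass_boundary_eq_zero hnull hC₀ hr₀)
  have hθ := MCD.tendsto_theta_perturb hk x hγ0 hγ1' hδ hτ hR he he1 heγ htame hnull hφ₀ huniq
    hout hφ
  have hne : ‖MCD.standardize x (MCD.theta P₀ γ φ₀)‖ ≠ (MCD.theta P₀ γ φ₀).2.2 := by
    intro h
    refine hx (MCD.setOf_quad_eq_subset_frontier _ hr₀ ?_)
    have h1 := MCD.norm_standardize_sq γ hC₀ x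
    rw [h] at h1
    exact h1.symm
  have hdet : (MCD.theta P₀ γ φ₀).2.1.mat.det ≠ 0 := (MCD.isUnit_symSqrt hC₀).ne_zero
  have hg := MCD.tendsto_score γ x hθ hdet hne
  refine MCD.tendsto_diff_quotient_of_zero hD hzero hθ hg ?_
  have hz := MCD.tendsto_standardize x hθ hdet
  have hrad : Tendsto (fun ε => (MCD.theta (MCD.perturb P₀ x ε) γ (φ ε)).2.2) (𝓝[>] 0)
      (𝓝 (MCD.theta P₀ γ φ₀).2.2) := ((continuous_snd.comp continuous_snd).tendsto _).comp hθ
  -- For small `ε` the point `x` is also off the boundary of the perturbed ellipsoid, so that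
  -- boundary is null for `P_{ε,x}` including its atom, and the estimating equation holds exactly.
  have hne' := (hz.norm.sub hrad).eventually_ne (sub_ne_zero.2 hne)
  filter_upwards [hφ, hIcc, hne'] with ε hφε hε hxε
  have h01 : ε ∈ Set.Icc (0 : ℝ) 1 := ⟨hε.1, hε.2.trans he1.le⟩
  have := MCD.isProbabilityMeasure_perturb P₀ x h01
  obtain ⟨hC, hr, hstep⟩ := MCD.isStep_of_isMinimizing_perturb hk x hγ0 hγ1' hδ hτ h01
    (hε.2.trans_lt heγ) (htame ε hε) hnull hφε
  have hb : MCD.perturb P₀ x ε {y | MCD.trimDist (MCD.perturb P₀ x ε) (φ ε) y =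
      MCD.trimRadius (MCD.perturb P₀ x ε) γ (φ ε) ^ 2} = 0 := by
    have h1 := MCD.mass_boundary_eq_zero hnull hC hr
    rw [measure_eq_zero_iff_ae_notMem] at h1 ⊢
    refine MCD.ae_perturb h1 fun hmem => hxε (sub_eq_zero.2 ?_)
    have h2 : MCD.trimDist (MCD.perturb P₀ x ε) (φ ε) x =
      MCD.trimRadius (MCD.perturb P₀ x ε) γ (φ ε) ^ 2 := hmem
    rw [← MCD.norm_standardize_sq γ hC] at h2
    exact (pow_left_inj₀ (norm_nonneg _) hr.le two_ne_zero).1 h2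
  have h3 := hstep.meanScore_eq_zero hγ0 hC hb
  rwa [MCD.meanScore, MCD.integral_perturb h01 (MCD.integrable_score hC)] at h3
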